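/- Let $d\ge 1$ and $n\ge 2$ be integers. Let $G(d,1,n)$ be the group generated by $s_1,\dots,s_n$ with defining relations $s_n^d=1$; $s_i^2=1$ for $1\le i\le n-1$; $s_is_j=s_js_i$ for $j+1<i\le n$; $s_{i+1}s_is_{i+1}=s_is_{i+1}s_i$ for $1\le i\le n-2$; $s_ns_{n-1}s_ns_{n-1}=s_{n-1}s_ns_{n-1}s_n$. For $r\mid d$ let $G(d,r,n)$ be the group generated by $\tilde s_1,\dots,\tilde s_n,\tilde s$ with defining relations $\tilde s^{\,d/r}=1$; $\tilde s_i^2=1$ for $1\le i\le n$; $\tilde s_i\tilde s_j=\tilde s_j\tilde s_i$ for $j+1<i\le n-1$; $\tilde s\tilde s_j=\tilde s_j\tilde s$ for $j\le n-2$; $\tilde s_n\tilde s_j=\tilde s_j\tilde s_n$ for $j\le n-3$; $\tilde s_{i+1}\tilde s_i\tilde s_{i+1}=\tilde s_i\tilde s_{i+1}\tilde s_i$ for $1\le i\le n-2$; $\tilde s\tilde s_n\tilde s_{n-1}=\tilde s_n\tilde s_{n-1}\tilde s$; $\tilde s\tilde s_n(\tilde s_{n-1}\tilde s_n)^{r-1}=\tilde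 s_{n-1}\tilde s$; and, if $n\ge3$, $\tilde s_n\tilde s_{n-2}\tilde s_n=\tilde s_{n-2}\tilde s_n\tilde s_{n-2}$ and $(\tilde s_n\tilde s_{n-1}\tilde s_{n-2})^2=(\tilde s_{n-2}\tilde s_n\tilde s_{n-1})^2$. Let $G(d,d,n)'$ be the group generated by $\tilde s_1,\dots,\tilde s_n$ with defining relations $\tilde s_i^2=1$ for $1\le i\le n$; $(\tilde s_n\tilde s_{n-1})^d=1$; and those of the above relations that do not involve $\tilde s$. For $i\ge j$ put $s_{ij}=s_is_{i-1}\cdots s_j$, for $i<j$ let $s_{ij}$ be empty, and for $k\ge1$ put $s^{(k)}_{nj}=s_n^k s_{n-1,j}$. A canonical word of $G(d,1,n)$ is a word $$s_{1i_1}s_{2i_2}\cdots s_{n-1,i_{n-1}}\,s^{(k_1)}_{nj_1}s^{(k_2)}_{nj_2}\cdots s^{(k_\ell)}_{nj_\ell}$$ with $1\le i_p\le p+1$ for $1\le p\le n-1$, $\ell\ge0$, $1\le j_1<\dots<j_\ell\le n$ and $1\le k_p\le d-1$ for $1\le p\le\ell$. Every element of $G(d,1,n)$ is expressed by exactly one canonical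 word. For every $r\mid d$ there is a homomorphism $\tau:G(d,r,n)\to G(d,1,n)$ with $\tau(\tilde s)=s_n^r$, $\tau(\tilde s_n)=s_n^{d-1}s_{n-1}s_n$ and $\tau(\tilde s_i)=s_i$ for $1\le i\le n-1$. It is injective, and its image is exactly the set of elements whose canonical word satisfies $k_1+\dots+k_\ell\equiv0\pmod r$. Likewise there is a homomorphism $\iota:G(d,d,n)'\to G(d,1,n)$ with $\iota(\tilde s_n)=s_n^{d-1}s_{n-1}s_n$ and $\iota(\tilde s_i)=s_i$ for $1\le i\le n-1$. It is injective, and its image is exactly the set of elements whose canonical word satisfies $k_1+\dots+k_\ell\equiv0\pmod d$. -/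

import Mathlib

namespace CRG

/-- The index set `{1, …, n}`. -/
abbrev Idx (n : ℕ) : Type := {i : ℕ // 1 ≤ i ∧ i ≤ n}

/-- The relators `a * b⁻¹` of a family of relations `a = b` in a free group. -/
def relators {α : Type} (R : FreeGroup α → FreeGroup α → Prop) : Set (FreeGroup α) :=
  {w | ∃ a b, R a b ∧ w = a * b⁻¹}

/-! ### The group `G(d,1,n)` -/

/-- The free generator with index `i`, for `1 ≤ i ≤ n`; the value `1` at any other `i` is a dummy
that is never used in the relations. -/
def x (n i : ℕ) : FreeGroup (Idx n) :=
  if h : 1 ≤ i ∧ i ≤ n then FreeGroup.of ⟨i, h⟩ else 1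

/-- The defining relations of `G(d,1,n)`. -/
inductive RelOne (d n : ℕ) : FreeGroup (Idx n) → FreeGroup (Idx n) → Prop
  | order_last (hn : 1 ≤ n) : RelOne d n (x n n ^ d) 1
  | order (i : ℕ) (h1 : 1 ≤ i) (h2 : i + 1 ≤ n) : RelOne d n (x n i ^ 2) 1
  | comm (i j : ℕ) (h1 : 1 ≤ j) (h2 : j + 1 < i) (h3 : i ≤ n) :
      RelOne d n (x n i * x n j) (x n j * x n i)
  | braid (i : ℕ) (h1 : 1 ≤ i) (h2 : i + 2 ≤ n) :
      RelOne d n (x n (i + 1) * x n i * x n (i + 1)) (x n i * x n (i + 1) * x n i)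
  | quad (hn : 2 ≤ n) :
      RelOne d n (x n n * x n (n - 1) * x n n * x n (n - 1))
        (x n (n - 1) * x n n * x n (n - 1) * x n n)

/-- The group `G(d,1,n)`, by generators and relations. -/
abbrev GOne (d n : ℕ) : Type := PresentedGroup (relators (RelOne d n))

/-- The generator `s_i` of `G(d,1,n)`, for `1 ≤ i ≤ n`. -/
def s (d n i : ℕ) : GOne d n := PresentedGroup.mk (relators (RelOne d n)) (x n i)

/-! ### The group `G(d,r,n)` for `r ∣ d` -/

/-- The names of the generators of `G(d,r,n)`: `s̃_1, …, s̃_n` and `s̃`. -/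
inductive Gen (n : ℕ) : Type
  | idx (i : Idx n)
  | extra

/-- The free generator for `s̃_i`, `1 ≤ i ≤ n` (with the dummy value `1` at any other `i`). -/
def y (n i : ℕ) : FreeGroup (Gen n) :=
  if h : 1 ≤ i ∧ i ≤ n then FreeGroup.of (Gen.idx ⟨i, h⟩) else 1

/-- The free generator for `s̃`. -/
def z (n : ℕ) : FreeGroup (Gen n) := FreeGroup.of Gen.extra

/-- The defining relations of `G(d,r,n)`, where `e = d / r`. A relation that mentions `s̃_{n-1}` or
`s̃_{n-2}` is present when that generator exists. -/
inductive RelR (d r n : ℕ) : FreeGroup (Gen n) → FreeGroup (Gen n) → Prop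
  | order_extra : RelR d r n (z n ^ (d / r)) 1
  | order (i : ℕ) (h1 : 1 ≤ i) (h2 : i ≤ n) : RelR d r n (y n i ^ 2) 1
  | comm (i j : ℕ) (h1 : 1 ≤ j) (h2 : j + 1 < i) (h3 : i + 1 ≤ n) :
      RelR d r n (y n i * y n j) (y n j * y n i)
  | comm_extra (j : ℕ) (h1 : 1 ≤ j) (h2 : j + 2 ≤ n) :
      RelR d r n (z n * y n j) (y n j * z n)
  | comm_last (j : ℕ) (h1 : 1 ≤ j) (h2 : j + 3 ≤ n) :
      RelR d r n (y n n * y n j) (y n j * y n n)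
  | braid (i : ℕ) (h1 : 1 ≤ i) (h2 : i + 2 ≤ n) :
      RelR d r n (y n (i + 1) * y n i * y n (i + 1)) (y n i * y n (i + 1) * y n i)
  | extra_comm (hn : 2 ≤ n) :
      RelR d r n (z n * y n n * y n (n - 1)) (y n n * y n (n - 1) * z n)
  | braid_last (hn : 3 ≤ n) :
      RelR d r n (y n n * y n (n - 2) * y n n) (y n (n - 2) * y n n * y n (n - 2))
  | square (hn : 3 ≤ n) :
      RelR d r n ((y n n * y n (n - 1) * y n (n - 2)) ^ 2)
        ((y n (n - 2) * y n n * y n (n - 1)) ^ 2)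
  | extra_long (hn : 2 ≤ n) :
      RelR d r n (z n * y n n * (y n (n - 1) * y n n) ^ (r - 1)) (y n (n - 1) * z n)

/-- The group `G(d,r,n)`, by generators and relations. -/
abbrev GR (d r n : ℕ) : Type := PresentedGroup (relators (RelR d r n))

/-- The generator `s̃_i` of `G(d,r,n)`, for `1 ≤ i ≤ n`. -/
def sR (d r n i : ℕ) : GR d r n := PresentedGroup.mk (relators (RelR d r n)) (y n i)

/-- The generator `s̃` of `G(d,r,n)`. -/
def sExtra (d r n : ℕ) : GR d r n := PresentedGroup.mk (relators (RelR d r n)) (z n)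

/-! ### The group `G(d,d,n)` in its own presentation -/

/-- The defining relations of `G(d,d,n)` on the generators `s̃_1, …, s̃_n`. A relation that mentions
`s̃_{n-1}` or `s̃_{n-2}` is present when that generator exists. -/
inductive RelD (d n : ℕ) : FreeGroup (Idx n) → FreeGroup (Idx n) → Prop
  | order (i : ℕ) (h1 : 1 ≤ i) (h2 : i ≤ n) : RelD d n (x n i ^ 2) 1
  | order_prod (hn : 2 ≤ n) : RelD d n ((x n n * x n (n - 1)) ^ d) 1
  | comm (i j : ℕ) (h1 : 1 ≤ j) (h2 : j + 1 < i) (h3 : i + 1 ≤ n) :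
      RelD d n (x n i * x n j) (x n j * x n i)
  | comm_last (j : ℕ) (h1 : 1 ≤ j) (h2 : j + 3 ≤ n) :
      RelD d n (x n n * x n j) (x n j * x n n)
  | braid (i : ℕ) (h1 : 1 ≤ i) (h2 : i + 2 ≤ n) :
      RelD d n (x n (i + 1) * x n i * x n (i + 1)) (x n i * x n (i + 1) * x n i)
  | braid_last (hn : 3 ≤ n) :
      RelD d n (x n n * x n (n - 2) * x n n) (x n (n - 2) * x n n * x n (n - 2))
  | square (hn : 3 ≤ n) :
      RelD d n ((x n n * x n (n - 1) * x n (n - 2)) ^ 2)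
        ((x n (n - 2) * x n n * x n (n - 1)) ^ 2)

/-- The group `G(d,d,n)`, by generators and relations. -/
abbrev GD (d n : ℕ) : Type := PresentedGroup (relators (RelD d n))

/-- The generator `s̃_i` of `G(d,d,n)`, for `1 ≤ i ≤ n`. -/
def sD (d n i : ℕ) : GD d n := PresentedGroup.mk (relators (RelD d n)) (x n i)

/-! ### Canonical words of `G(d,1,n)` -/

/-- The word `s_{ij} = [i, i-1, …, j]`, which is `[i]` for `i = j` and empty for `i < j`. -/
def sWord (i j : ℕ) : List ℕ := (List.range' j (i + 1 - j)).reverse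

/-- The word `s_{nj}^{(k)} = s_n^k s_{n-1,j}`. -/
def sPowWord (n k j : ℕ) : List ℕ := List.replicate k n ++ sWord (n - 1) j

/-- The parameters `i_1, …, i_{n-1}` and `(j_1,k_1), …, (j_ℓ,k_ℓ)` of a canonical word
`s_{1 i_1} ⋯ s_{n-1, i_{n-1}} s_{n j_1}^{(k_1)} ⋯ s_{n j_ℓ}^{(k_ℓ)}` of `G(d,1,n)`. -/
@[ext]
structure CanonicalWord (d n : ℕ) where
  /-- `i p` is `i_{p+1}`, for `p = 0, …, n - 2`. -/
  i : Fin (n - 1) → ℕ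
  one_le_i : ∀ p, 1 ≤ i p
  i_le : ∀ p : Fin (n - 1), i p ≤ (p : ℕ) + 2
  /-- The list `(j_1,k_1), …, (j_ℓ,k_ℓ)`. -/
  jk : List (ℕ × ℕ)
  j_lt : jk.Pairwise fun a b => a.1 < b.1
  j_mem : ∀ a ∈ jk, 1 ≤ a.1 ∧ a.1 ≤ n
  k_mem : ∀ a ∈ jk, 1 ≤ a.2 ∧ a.2 ≤ d - 1

namespace CanonicalWord

variable {d n : ℕ}

/-- The underlying word in the alphabet `{1, …, n}`. -/
def word (c : CanonicalWord d n) : List ℕ :=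
  (List.ofFn fun p : Fin (n - 1) => sWord ((p : ℕ) + 1) (c.i p)).flatten ++
    (c.jk.map fun a => sPowWord n a.2 a.1).flatten

/-- The element of `G(d,1,n)` that the word expresses. -/
def toGroup (c : CanonicalWord d n) : GOne d n := (c.word.map (s d n)).prod

/-- The sum `k_1 + ⋯ + k_ℓ`. -/
def kSum (c : CanonicalWord d n) : ℕ := (c.jk.map Prod.snd).sum

end CanonicalWord

/-- The set `𝒲(d,r,n)` of the canonical words of `G(d,1,n)` with `k_1 + ⋯ + k_ℓ ≡ 0 (mod r)`. -/
def canonicalWords (d r n : ℕ) : Set (CanonicalWord d n) := {c | c.kSum ≡ 0 [MOD r]}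

end CRG

/-! Let c_j = s_{n-1}⋯s_j and t_j = c_j⁻¹ s_n c_j. In G(d,1,n) the t_j commute, have d-th power 1
and are permuted by s_1, …, s_{n-1}, so every element is a type A normal form times a product of
powers of the t_j. The group acts on ℕ × ZMod d by monomial permutations: s_i swaps i and i+1 for i
< n, and t_j adds 1 in the fibre over j. This action reads off the permutation and the exponents
modulo d, hence is faithful (`toMon_injective`).

Since s_n^k c_j = c_j t_j^k, and t_j commutes with c_{j'} for j < j', a canonical word equals a type
A normal form, times c_{j_1}⋯c_{j_ℓ}, times ∏ t_{j_p}^{k_p} (`toGroup_eq`). The exponents determine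
the middle factor; cancelling it reduces existence and uniqueness to type A.

In G(d,r,n) put u = s̃_n s̃_{n-1}. It goes to t_n⁻¹ t_{n-1}, its conjugates u_j go to t_n⁻¹ t_j, and
s̃ goes to t_n^r. The relations alone show that the u_j and s̃ commute, that s̃_1, …, s̃_{n-1}
normalize the group they generate (`conj_diagFam_mem`), and that u_j^d = 1. So again every element
is a normal form times a diagonal part, and the monomial action composed with τ detects both parts
(`injective_of_image`).

The homomorphism to ZMod r with s_n ↦ 1 and s_i ↦ 0 for i < n sends a canonical word to the sum of
the k_p. Its kernel contains the image of τ, and equals it because every element of G(d,1,n) is an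
element of the image times a power of s_n (`ker_degree_le`). The group G(d,d,n)' satisfies the
relations `SatR` with s̃ = 1, so the same lemmas cover it. -/

namespace CRG

/-! ### Type A relations: normal forms and families of conjugates -/

section TypeA

variable {G : Type*} [Group G]

/-- The elements `s 1, …, s m` satisfy the Coxeter relations of type `A`. -/
structure TypeA (s : ℕ → G) (m : ℕ) : Prop where
  sq : ∀ i, 1 ≤ i → i ≤ m → s i * s i = 1
  comm : ∀ i j, 1 ≤ j → j + 1 < i → i ≤ m → s i * s j = s j * s i
  braid : ∀ i, 1 ≤ i → i + 1 ≤ m → s (i + 1) * s i * s (i + 1) = s i * s (i + 1) * s i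

/-- The subgroup generated by `s 1, …, s m`. -/
def para (s : ℕ → G) (m : ℕ) : Subgroup G := Subgroup.closure (s '' Set.Icc 1 m)

/-- The product `s m * s (m - 1) * ⋯ * s i`. -/
def cyc (s : ℕ → G) (m i : ℕ) : G := ((sWord m i).map s).prod

/-- The product `cyc s 1 (i 1) * ⋯ * cyc s m (i m)`. -/
def nf (s : ℕ → G) (i : ℕ → ℕ) : ℕ → G
  | 0 => 1
  | m + 1 => nf s i m * cyc s (m + 1) (i (m + 1))

variable {s : ℕ → G} {m : ℕ}

theorem TypeA.mono {k : ℕ} (h : TypeA s m) (hk : k ≤ m) : TypeA s k :=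
  ⟨fun i h1 h2 => h.sq i h1 (h2.trans hk), fun i j h1 h2 h3 => h.comm i j h1 h2 (h3.trans hk),
    fun i h1 h2 => h.braid i h1 (h2.trans hk)⟩

theorem TypeA.inv (h : TypeA s m) {i : ℕ} (h1 : 1 ≤ i) (h2 : i ≤ m) : (s i)⁻¹ = s i :=
  inv_eq_of_mul_eq_one_left (h.sq i h1 h2)

theorem mem_para {i : ℕ} (h1 : 1 ≤ i) (h2 : i ≤ m) : s i ∈ para s m :=
  Subgroup.subset_closure ⟨i, ⟨h1, h2⟩, rfl⟩

theorem para_mono {k : ℕ} (hk : k ≤ m) : para s k ≤ para s m :=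
  Subgroup.closure_mono (Set.image_mono (Set.Icc_subset_Icc_right hk))

theorem cyc_of_lt {i : ℕ} (h : m < i) : cyc s m i = 1 := by
  have : m + 1 - i = 0 := by omega
  simp [cyc, sWord, this]

theorem cyc_of_le {i : ℕ} (h : i ≤ m) : cyc s m i = cyc s m (i + 1) * s i := by
  have : m + 1 - i = (m + 1 - (i + 1)) + 1 := by omega
  simp [cyc, sWord, this, List.range'_succ]

theorem nf_succ : nf s (· + 1) m = 1 := by
  induction m with
  | zero => rfl
  | succ m ih => rw [nf, ih, cyc_of_lt (by omega), one_mul]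

theorem cyc_self : cyc s m m = s m := by
  rw [cyc_of_le le_rfl, cyc_of_lt (Nat.lt_succ_self m), one_mul]

theorem cyc_mem_para {i : ℕ} (hi : 1 ≤ i) : cyc s m i ∈ para s m := by
  refine Subgroup.list_prod_mem _ fun g hg => ?_
  simp only [sWord, List.mem_map, List.mem_reverse, List.mem_range'_1] at hg
  obtain ⟨k, hk, rfl⟩ := hg
  exact mem_para (by omega) (by omega)

theorem map_cyc {H : Type*} [Group H] (f : G →* H) (i : ℕ) :
    f (cyc s m i) = cyc (f ∘ s) m i := by
  simp [cyc, map_list_prod]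

theorem map_nf {H : Type*} [Group H] (f : G →* H) (i : ℕ → ℕ) :
    f (nf s i m) = nf (f ∘ s) i m := by
  induction m with
  | zero => simp [nf]
  | succ m ih => simp [nf, ih, map_cyc]

theorem cyc_congr {s' : ℕ → G} (h : ∀ p, 1 ≤ p → p ≤ m → s p = s' p) {i : ℕ} (hi : 1 ≤ i) :
    cyc s m i = cyc s' m i := by
  refine congrArg List.prod (List.map_congr_left fun k hk => ?_)
  simp only [sWord, List.mem_reverse, List.mem_range'_1] at hk
  exact h k (by omega) (by omega)

theorem nf_congr_left {s' : ℕ → G} (h : ∀ p, 1 ≤ p → p ≤ m → s p = s' p) {i : ℕ → ℕ}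
    (hi : ∀ p, 1 ≤ i p) : nf s i m = nf s' i m := by
  induction m with
  | zero => rfl
  | succ m ih => rw [nf, nf, ih fun p h1 h2 => h p h1 (by omega), cyc_congr h (hi _)]

theorem nf_mem_para {i : ℕ → ℕ} (hi : ∀ p, 1 ≤ i p) : nf s i m ∈ para s m := by
  induction m with
  | zero => exact one_mem _
  | succ m ih => exact mul_mem (para_mono m.le_succ ih) (cyc_mem_para (hi _))

theorem nf_congr {i j : ℕ → ℕ} (h : ∀ p, 1 ≤ p → p ≤ m → i p = j p) : nf s i m = nf s j m := by
  induction m with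
  | zero => rfl
  | succ m ih =>
    rw [nf, nf, ih fun p h1 h2 => h p h1 (by omega), h _ (by omega) le_rfl]

theorem TypeA.cyc_mul_of_lt (h : TypeA s m) {i j : ℕ} (hj : 1 ≤ j) (hji : j + 1 < i) :
    cyc s m i * s j = s j * cyc s m i := by
  refine Commute.list_prod_left ((sWord _ _).map s) _ fun g hg => ?_
  simp only [sWord, List.mem_map, List.mem_reverse, List.mem_range'_1] at hg
  obtain ⟨k, hk, rfl⟩ := hg
  exact h.comm k j hj (by omega) (by omega)

theorem TypeA.cyc_mul_of_gt (h : TypeA s m) {i k : ℕ} (hi : 1 ≤ i) (hik : i ≤ k)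
    (hk : k + 1 ≤ m) : cyc s m i * s (k + 1) = s k * cyc s m i := by
  obtain ⟨e, rfl⟩ := Nat.exists_eq_add_of_le hik
  induction e generalizing i with
  | zero =>
    rw [add_zero] at hk ⊢
    rw [cyc_of_le (by omega : i ≤ m), cyc_of_le hk]
    simp only [mul_assoc]
    rw [← mul_assoc (s (i + 1)), h.braid i hi hk, mul_assoc, ← mul_assoc,
      h.cyc_mul_of_lt hi (by omega), mul_assoc]
  | succ e ih =>
    have := @ih (i + 1) (by omega) (by omega) (by omega)
    rw [show i + (e + 1) = i + 1 + e by omega, cyc_of_le (by omega : i ≤ m), mul_assoc,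
      ← h.comm (i + 1 + e + 1) i hi (by omega) (by omega), ← mul_assoc, this, mul_assoc]

/-- The elements `cyc s m j` represent the right cosets of `para s (m - 1)` in `para s m`, and right
multiplication by `s i` permutes these cosets as the transposition of i and i+1 does. -/
theorem TypeA.exists_cyc_mul (h : TypeA s m) {i j : ℕ} (hi : 1 ≤ i) (him : i ≤ m) (hj : 1 ≤ j)
    (hjm : j ≤ m + 1) :
    ∃ w ∈ para s (m - 1), cyc s m j * s i = w * cyc s m (Equiv.swap i (i + 1) j) := by
  rcases lt_trichotomy j i with hji | rfl | hij
  · obtain ⟨k, rfl⟩ : ∃ k, i = k + 1 := ⟨i - 1, by omega⟩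
    refine ⟨s k, mem_para (by omega) (by omega), ?_⟩
    rw [Equiv.swap_apply_of_ne_of_ne (by omega) (by omega),
      h.cyc_mul_of_gt hj (by omega) him]
  · refine ⟨1, one_mem _, ?_⟩
    rw [Equiv.swap_apply_left, one_mul, cyc_of_le him, mul_assoc, h.sq j hi him, mul_one]
  · rcases (Nat.succ_le_of_lt hij).eq_or_lt with rfl | hij'
    · refine ⟨1, one_mem _, ?_⟩
      rw [Nat.succ_eq_add_one, Equiv.swap_apply_right, one_mul, ← cyc_of_le him]
    · refine ⟨s i, mem_para hi (by omega), ?_⟩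
      rw [Equiv.swap_apply_of_ne_of_ne (by omega) (by omega), h.cyc_mul_of_lt hi hij']

theorem swap_succ_mem {i j m : ℕ} (hi : 1 ≤ i) (him : i ≤ m) (hj : 1 ≤ j) (hjm : j ≤ m + 1) :
    1 ≤ Equiv.swap i (i + 1) j ∧ Equiv.swap i (i + 1) j ≤ m + 1 := by
  rw [Equiv.swap_apply_def]
  split_ifs <;> omega

theorem TypeA.para_induction (h : TypeA s m) {P : G → Prop} (one : P 1)
    (mul : ∀ g i, 1 ≤ i → i ≤ m → P g → P (g * s i)) {g : G} (hg : g ∈ para s m) : P g := by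
  induction hg using Subgroup.closure_induction_right with
  | one => exact one
  | mul_right x _ y hy ih =>
    obtain ⟨i, hi, rfl⟩ := hy
    exact mul x i hi.1 hi.2 ih
  | mul_inv_cancel x _ y hy ih =>
    obtain ⟨i, hi, rfl⟩ := hy
    rw [h.inv hi.1 hi.2]
    exact mul x i hi.1 hi.2 ih

/-- Every element of the group generated by `s 1, …, s m` has a normal form. -/
theorem TypeA.exists_nf (h : TypeA s m) {g : G} (hg : g ∈ para s m) :
    ∃ i : ℕ → ℕ, (∀ p, 1 ≤ i p ∧ i p ≤ p + 1) ∧ g = nf s i m := by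
  induction m generalizing g with
  | zero =>
    refine ⟨fun _ => 1, fun p => ⟨le_rfl, by simp⟩, ?_⟩
    simpa [para, nf] using hg
  | succ m ih =>
    suffices ∃ w ∈ para s m, ∃ j, 1 ≤ j ∧ j ≤ m + 2 ∧ g = w * cyc s (m + 1) j by
      obtain ⟨w, hw, j, h1, h2, rfl⟩ := this
      obtain ⟨i, hi, rfl⟩ := ih (h.mono m.le_succ) hw
      refine ⟨Function.update i (m + 1) j, fun p => ?_, ?_⟩
      · by_cases hp : p = m + 1
        · subst hp; simp; omega
        · simpa [hp] using hi p
      · rw [nf, Function.update_self,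
          nf_congr fun p _ h2 => Function.update_of_ne (by omega : p ≠ m + 1) j i]
    refine h.para_induction (P := fun g => ∃ w ∈ para s m, ∃ j, 1 ≤ j ∧ j ≤ m + 2 ∧
      g = w * cyc s (m + 1) j) ⟨1, one_mem _, m + 2, by omega, le_rfl, ?_⟩ ?_ hg
    · rw [cyc_of_lt (by omega), one_mul]
    · rintro _ i hi him ⟨w, hw, j, hj, hjm, rfl⟩
      obtain ⟨v, hv, hvj⟩ := h.exists_cyc_mul hi him hj hjm
      have := swap_succ_mem hi him hj hjm
      exact ⟨w * v, mul_mem hw hv, _, this.1, this.2, by rw [mul_assoc, hvj, mul_assoc]⟩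

/-- The word of the first part of a canonical word expresses `nf`. -/
theorem prod_flatten_ofFn (s : ℕ → G) (i : ℕ → ℕ) (m : ℕ) :
    ((List.ofFn fun p : Fin m => sWord (p + 1) (i (p + 1))).flatten.map s).prod = nf s i m := by
  induction m with
  | zero => simp [nf]
  | succ m ih =>
    rw [List.ofFn_succ_last, List.flatten_append, List.map_append, List.prod_append, nf]
    simp only [Fin.val_castSucc, ih]
    simp [cyc]

/-! ### A family of conjugates indexed by `1, …, m + 1` -/

/-- The conjugates of `t` that are permuted by `s 1, …, s m`, if `t` commutes with
`s 1, …, s (m - 1)`. -/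
def conjFam (s : ℕ → G) (m : ℕ) (t : G) (j : ℕ) : G := (cyc s m j)⁻¹ * t * cyc s m j

variable {t : G}

theorem conjFam_top : conjFam s m t (m + 1) = t := by
  simp [conjFam, cyc_of_lt]

theorem map_conjFam {H : Type*} [Group H] (f : G →* H) (j : ℕ) :
    f (conjFam s m t j) = conjFam (f ∘ s) m (f t) j := by
  simp [conjFam, map_cyc]

theorem conjFam_pow (t : G) (j k : ℕ) : conjFam s m (t ^ k) j = conjFam s m t j ^ k := by
  have := conj_pow (i := k) (a := (cyc s m j)⁻¹) (b := t)
  simpa [conjFam] using this.symm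

theorem cyc_mul_conjFam (j : ℕ) : cyc s m j * conjFam s m t j = t * cyc s m j := by
  simp [conjFam, mul_assoc]

theorem commute_of_mem_para {k : ℕ} (ht : ∀ i, 1 ≤ i → i ≤ k → s i * t = t * s i) {w : G}
    (hw : w ∈ para s k) : Commute w t := by
  have : para s k ≤ Subgroup.centralizer {t} := by
    refine (Subgroup.closure_le _).2 ?_
    rintro _ ⟨i, hi, rfl⟩
    exact Subgroup.mem_centralizer_singleton_iff.2 (ht i hi.1 hi.2)
  exact Subgroup.mem_centralizer_singleton_iff.1 (this hw)

theorem TypeA.conjFam_mul (h : TypeA s m) (ht : ∀ i, 1 ≤ i → i + 1 ≤ m → s i * t = t * s i)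
    {i j : ℕ} (hi : 1 ≤ i) (him : i ≤ m) (hj : 1 ≤ j) (hjm : j ≤ m + 1) :
    conjFam s m t j * s i = s i * conjFam s m t (Equiv.swap i (i + 1) j) := by
  obtain ⟨w, hw, e⟩ := h.exists_cyc_mul hi him hj hjm
  have hwt : Commute w t := commute_of_mem_para (fun i h1 h2 => ht i h1 (by omega)) hw
  have e' : cyc s m (Equiv.swap i (i + 1) j) = w⁻¹ * (cyc s m j * s i) := by rw [e]; group
  rw [conjFam, conjFam, e']
  calc _ = (cyc s m j)⁻¹ * (t * w) * w⁻¹ * cyc s m j * s i := by group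
    _ = (cyc s m j)⁻¹ * (w * t) * w⁻¹ * cyc s m j * s i := by rw [hwt.eq]
    _ = _ := by group

/-- Every letter of `cyc s m k` has index at least k, so its transposition fixes j < k. -/
theorem TypeA.cyc_mul_conjFam_of_lt (h : TypeA s m)
    (ht : ∀ i, 1 ≤ i → i + 1 ≤ m → s i * t = t * s i)
    {j k : ℕ} (hj : 1 ≤ j) (hjk : j < k) (hkm : k ≤ m + 1) :
    cyc s m k * conjFam s m t j = conjFam s m t j * cyc s m k := by
  refine Commute.list_prod_left ((sWord _ _).map s) _ fun g hg => ?_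
  simp only [sWord, List.mem_map, List.mem_reverse, List.mem_range'_1] at hg
  obtain ⟨i, hi, rfl⟩ := hg
  have := h.conjFam_mul ht (by omega : 1 ≤ i) (by omega) hj (by omega)
  rw [Equiv.swap_apply_of_ne_of_ne (by omega) (by omega)] at this
  exact this.symm

/-- Only the top index has to be checked: `s j` with j < m commutes with v and w and carries the
conjugate at j+1 to the one at j, which gives a descending induction. Used with v = t, w = 1 for
commutation, and with w = u⁻¹ for the action of s̃_{n-1} on the diagonal part. -/
theorem TypeA.mul_conjFam (h : TypeA s m) {t v w : G}
    (ht : ∀ i, 1 ≤ i → i + 1 ≤ m → s i * t = t * s i)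
    (hv : ∀ i, 1 ≤ i → i + 1 ≤ m → s i * v = v * s i)
    (hw : ∀ i, 1 ≤ i → i + 1 ≤ m → s i * w = w * s i)
    (htv : v * conjFam s m t m = w * conjFam s m t m * v) {j : ℕ} (hj : 1 ≤ j) (hjm : j ≤ m) :
    v * conjFam s m t j = w * conjFam s m t j * v := by
  obtain ⟨e, he⟩ := Nat.exists_eq_add_of_le hjm
  induction e generalizing j with
  | zero => rwa [show j = m by omega]
  | succ e ih =>
    have h1 := @ih (j + 1) (by omega) (by omega) (by omega)
    have h2 := h.conjFam_mul ht hj hjm hj (by omega)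
    rw [Equiv.swap_apply_left] at h2
    have h3 := hv j hj (by omega)
    have h4 := hw j hj (by omega)
    refine mul_right_cancel (b := s j) ?_
    rw [mul_assoc, h2, ← mul_assoc, ← h3, mul_assoc, h1, mul_assoc _ v, ← h3, ← mul_assoc,
      ← mul_assoc, h4, mul_assoc, mul_assoc, ← mul_assoc _ _ v, ← h2]
    simp only [mul_assoc, h3]

/-- For j < k, conjugation by `cyc s m k` fixes the conjugate at j and turns the one at k into t, so
it is enough that t commutes with the conjugates at j ≤ m; `mul_conjFam` reduces this to j = m. -/
theorem TypeA.conjFam_commute (h : TypeA s m) (ht : ∀ i, 1 ≤ i → i + 1 ≤ m → s i * t = t * s i)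
    (htt : 1 ≤ m → Commute t (conjFam s m t m)) {j k : ℕ} (hj : 1 ≤ j) (hjm : j ≤ m + 1)
    (hk : 1 ≤ k) (hkm : k ≤ m + 1) : Commute (conjFam s m t j) (conjFam s m t k) := by
  wlog hjk : j < k generalizing j k
  · rcases (not_lt.1 hjk).eq_or_lt with rfl | hlt
    · exact Commute.refl _
    · exact (this hk hkm hj hjm hlt).symm
  have h1 := h.cyc_mul_conjFam_of_lt ht hj hjk hkm
  have h2 : Commute t (conjFam s m t j) := by
    have := h.mul_conjFam (w := 1) ht ht (by simp) (by rw [one_mul]; exact htt (by omega)) hj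
      (by omega : j ≤ m)
    rwa [one_mul] at this
  have h3 : Commute (cyc s m k) (conjFam s m t j) := h1
  rw [conjFam.eq_1 s m t k]
  exact ((h3.inv_left.mul_left h2).mul_left h3).symm

end TypeA
end CRG

namespace CRG

/-! ### Products of powers of a commuting family -/

section Diagonal

variable {G : Type*} [Group G]

/-- The product `T 1 ^ e 1 * ⋯ * T n ^ e n`. -/
def tprod (T : ℕ → G) (e : ℕ → ℤ) : ℕ → G
  | 0 => 1
  | n + 1 => tprod T e n * T (n + 1) ^ e (n + 1)

variable {T : ℕ → G} {n : ℕ}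

theorem map_tprod {H : Type*} [Group H] (f : G →* H) (e : ℕ → ℤ) :
    f (tprod T e n) = tprod (f ∘ T) e n := by
  induction n with
  | zero => simp [tprod]
  | succ n ih => simp [tprod, ih]

theorem tprod_congr_left {T' : ℕ → G} {e : ℕ → ℤ} (h : ∀ j, 1 ≤ j → j ≤ n → T j = T' j) :
    tprod T e n = tprod T' e n := by
  induction n with
  | zero => rfl
  | succ n ih => rw [tprod, tprod, ih fun j h1 h2 => h j h1 (by omega), h _ (by omega) le_rfl]

theorem tprod_eq_one {e : ℕ → ℤ} (h : ∀ j, 1 ≤ j → j ≤ n → T j ^ e j = 1) : tprod T e n = 1 := by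
  induction n with
  | zero => rfl
  | succ n ih => rw [tprod, ih fun j h1 h2 => h j h1 (by omega), h _ (by omega) le_rfl, one_mul]

theorem commute_tprod {g : G} {e : ℕ → ℤ} (h : ∀ j, 1 ≤ j → j ≤ n → Commute g (T j)) :
    Commute g (tprod T e n) := by
  induction n with
  | zero => exact Commute.one_right g
  | succ n ih =>
    exact (ih fun j h1 h2 => h j h1 (by omega)).mul_right ((h _ (by omega) le_rfl).zpow_right _)

theorem tprod_add (h : ∀ j k, 1 ≤ j → j ≤ n → 1 ≤ k → k ≤ n → Commute (T j) (T k))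
    (e f : ℕ → ℤ) : tprod T (e + f) n = tprod T e n * tprod T f n := by
  induction n with
  | zero => simp [tprod]
  | succ n ih =>
    have : Commute (T (n + 1) ^ e (n + 1)) (tprod T f n) :=
      commute_tprod fun j h1 h2 => (h _ _ (by omega) le_rfl h1 (by omega)).zpow_left _
    rw [tprod, ih fun j k h1 h2 h3 h4 => h j k h1 (by omega) h3 (by omega), tprod, tprod,
      Pi.add_apply, zpow_add, mul_assoc, mul_assoc, ← mul_assoc (tprod T f n), ← this.eq, mul_assoc]

theorem tprod_single (j : ℕ) (hj : 1 ≤ j) (hjn : j ≤ n) : tprod T (Pi.single j 1) n = T j := by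
  induction n with
  | zero => omega
  | succ n ih =>
    rcases hjn.eq_or_lt with rfl | hlt
    · rw [tprod, Pi.single_eq_same, zpow_one, tprod_eq_one, one_mul]
      intro k _ hk
      rw [Pi.single_eq_of_ne (by omega), zpow_zero]
    · rw [tprod, ih (by omega), Pi.single_eq_of_ne (by omega), zpow_zero, mul_one]

theorem exists_tprod (h : ∀ j k, 1 ≤ j → j ≤ n → 1 ≤ k → k ≤ n → Commute (T j) (T k)) {g : G}
    (hg : g ∈ Subgroup.closure (T '' Set.Icc 1 n)) : ∃ e, g = tprod T e n := by
  induction hg using Subgroup.closure_induction with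
  | mem x hx =>
    obtain ⟨j, hj, rfl⟩ := hx
    exact ⟨Pi.single j 1, (tprod_single j hj.1 hj.2).symm⟩
  | one => exact ⟨0, (tprod_eq_one fun j _ _ => zpow_zero _).symm⟩
  | mul x y _ _ hx hy =>
    obtain ⟨e, rfl⟩ := hx
    obtain ⟨f, rfl⟩ := hy
    exact ⟨e + f, (tprod_add h e f).symm⟩
  | inv x _ hx =>
    obtain ⟨e, rfl⟩ := hx
    refine ⟨-e, inv_eq_of_mul_eq_one_left ?_⟩
    rw [← tprod_add h, neg_add_cancel]
    exact tprod_eq_one fun j _ _ => zpow_zero _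

theorem mem_normalizer_closure {K : Set G} {a : G} (ha : a * a = 1)
    (h : ∀ k ∈ K, a * k * a ∈ Subgroup.closure K) :
    a ∈ Subgroup.normalizer (Subgroup.closure K : Set G) := by
  have hinv : a⁻¹ = a := inv_eq_of_mul_eq_one_left ha
  have key : ∀ g ∈ Subgroup.closure K, a * g * a ∈ Subgroup.closure K := by
    have : Subgroup.closure K ≤ (Subgroup.closure K).comap (MulAut.conj a).toMonoidHom :=
      (Subgroup.closure_le _).2 fun k hk => by simpa [hinv] using h k hk
    intro g hg
    simpa [hinv] using this hg
  refine Subgroup.mem_normalizer_iff.2 fun g => ⟨fun hg => by simpa [hinv] using key g hg,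
    fun hg => ?_⟩
  have := key _ hg
  rw [hinv] at this
  simpa [mul_assoc, ha, ← mul_assoc a a] using this

/-- If `T` is a family of commuting elements whose group is normalized by the involutions
`s 1, …, s m`, every element of the group is a product of an element generated by `s` and a
product of powers of `T`. -/
theorem TypeA.exists_mul_tprod {s : ℕ → G} {m : ℕ} (hs : TypeA s m)
    (hT : ∀ j k, 1 ≤ j → j ≤ n → 1 ≤ k → k ≤ n → Commute (T j) (T k))
    (hsT : ∀ i j, 1 ≤ i → i ≤ m → 1 ≤ j → j ≤ n →
      s i * T j * s i ∈ Subgroup.closure (T '' Set.Icc 1 n))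
    (htop : para s m ⊔ Subgroup.closure (T '' Set.Icc 1 n) = ⊤) (g : G) :
    ∃ i : ℕ → ℕ, (∀ p, 1 ≤ i p ∧ i p ≤ p + 1) ∧ ∃ e, g = nf s i m * tprod T e n := by
  set D := Subgroup.closure (T '' Set.Icc 1 n)
  -- The normalizer of D contains D and every `s i`, and these generate the group.
  have hN : D.Normal := by
    rw [← Subgroup.normalizer_eq_top_iff, eq_top_iff, ← htop]
    refine sup_le ((Subgroup.closure_le _).2 ?_) Subgroup.le_normalizer
    rintro _ ⟨i, hi, rfl⟩
    refine mem_normalizer_closure (hs.sq i hi.1 hi.2) ?_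
    rintro _ ⟨j, hj, rfl⟩
    exact hsT i j hi.1 hi.2 hj.1 hj.2
  have hg : g ∈ para s m ⊔ D := htop ▸ Subgroup.mem_top g
  obtain ⟨σ, hσ, δ, hδ, rfl⟩ := Subgroup.mem_sup_of_normal_right.1 hg
  obtain ⟨i, hi, rfl⟩ := hs.exists_nf hσ
  obtain ⟨e, rfl⟩ := exists_tprod hT hδ
  exact ⟨i, hi, e, rfl⟩

end Diagonal

/-! ### The model: monomial permutations of ℕ × ZMod d -/

section Model

/-- The adjacent transpositions of `ℕ`. -/
def adj (i : ℕ) : Equiv.Perm ℕ := Equiv.swap i (i + 1)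

theorem typeA_adj (m : ℕ) : TypeA adj m where
  sq i _ _ := Equiv.swap_mul_self _ _
  comm i j _ h _ := by
    ext a
    simp only [adj, Equiv.Perm.mul_apply, Equiv.swap_apply_def]
    split_ifs <;> omega
  braid i _ _ := by
    ext a
    simp only [adj, Equiv.Perm.mul_apply, Equiv.swap_apply_def]
    split_ifs <;> omega

theorem cyc_adj_apply_self {m j : ℕ} (hj : j ≤ m + 1) : cyc adj m j j = m + 1 := by
  obtain ⟨e, he⟩ := Nat.exists_eq_add_of_le hj
  induction e generalizing j with
  | zero => rw [cyc_of_lt (by omega)]; simp; omega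
  | succ e ih =>
    rw [cyc_of_le (by omega), Equiv.Perm.mul_apply, adj, Equiv.swap_apply_left]
    exact ih (by omega) (by omega)

theorem apply_of_mem_para_adj {m a : ℕ} (ha : m + 1 < a) {p : Equiv.Perm ℕ}
    (hp : p ∈ para adj m) : p a = a := by
  have : para adj m ≤ MulAction.stabilizer (Equiv.Perm ℕ) a := by
    refine (Subgroup.closure_le _).2 ?_
    rintro _ ⟨i, hi, rfl⟩
    exact Equiv.swap_apply_of_ne_of_ne (by have := hi.2; omega) (by have := hi.2; omega)
  exact this hp

/-- The last parameter is the preimage of the largest moved point: the last factor sends i (m+1) to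
m+2, which the other factors fix. Then cancel the last factor and induct. -/
theorem nf_adj_injective {m : ℕ} {i j : ℕ → ℕ} (hi : ∀ p, 1 ≤ i p ∧ i p ≤ p + 1)
    (hj : ∀ p, 1 ≤ j p ∧ j p ≤ p + 1) (h : nf adj i m = nf adj j m) :
    ∀ p, 1 ≤ p → p ≤ m → i p = j p := by
  induction m with
  | zero => intro p; omega
  | succ m ih =>
    have key : ∀ i : ℕ → ℕ, (∀ p, 1 ≤ i p ∧ i p ≤ p + 1) →
        nf adj i (m + 1) (i (m + 1)) = m + 2 := fun i hi => by
      rw [nf, Equiv.Perm.mul_apply, cyc_adj_apply_self (hi _).2]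
      exact apply_of_mem_para_adj (by omega) (nf_mem_para fun p => (hi p).1)
    have e : i (m + 1) = j (m + 1) :=
      (nf adj i (m + 1)).injective ((key i hi).trans (by rw [h, key j hj]))
    intro p h1 h2
    rcases h2.eq_or_lt with rfl | hlt
    · exact e
    · rw [nf, nf, e] at h
      exact ih (mul_right_cancel h) p h1 (by omega)

/-- A trivial permutation forces i p = p + 1 for 1 ≤ p ≤ m, so every factor is an empty word,
whatever the group. -/
theorem nf_eq_one {G : Type*} [Group G] {s : ℕ → G} {m : ℕ} {i : ℕ → ℕ} (h : nf adj i m = 1)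
    (hi : ∀ p, 1 ≤ i p ∧ i p ≤ p + 1) : nf s i m = 1 := by
  rw [nf_congr (nf_adj_injective hi (j := (· + 1)) (by simp) (h.trans nf_succ.symm))]
  exact nf_succ

/-- The monomial permutation `(a, b) ↦ (p a, b + e a)`. -/
def mon {d : ℕ} (p : Equiv.Perm ℕ) (e : ℕ → ZMod d) : Equiv.Perm (ℕ × ZMod d) :=
  Equiv.prodShear p fun a => Equiv.addRight (e a)

variable {d : ℕ}

@[simp]
theorem mon_apply (p : Equiv.Perm ℕ) (e : ℕ → ZMod d) (a : ℕ) (b : ZMod d) :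
    mon p e (a, b) = (p a, b + e a) := rfl

theorem mon_mul (p q : Equiv.Perm ℕ) (e f : ℕ → ZMod d) :
    mon p e * mon q f = mon (p * q) (f + e ∘ q) := by
  ext ⟨a, b⟩ <;> simp [add_assoc]

theorem mon_one : mon (d := d) 1 0 = 1 := by
  ext ⟨a, b⟩ <;> simp

theorem mon_inj {p q : Equiv.Perm ℕ} {e f : ℕ → ZMod d} : mon p e = mon q f ↔ p = q ∧ e = f := by
  refine ⟨fun h => ?_, fun h => by rw [h.1, h.2]⟩
  have := fun a => Prod.ext_iff.1 (DFunLike.congr_fun h (a, (0 : ZMod d)))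
  exact ⟨Equiv.ext fun a => (this a).1, funext fun a => by simpa using (this a).2⟩

/-- The permutations among the monomial permutations. -/
def permHom (d : ℕ) : Equiv.Perm ℕ →* Equiv.Perm (ℕ × ZMod d) where
  toFun p := mon p 0
  map_one' := mon_one
  map_mul' p q := by rw [mon_mul]; exact congrArg _ (funext fun _ => (add_zero _).symm)

/-- The diagonal elements among the monomial permutations. -/
def diagHom (d : ℕ) : Multiplicative (ℕ → ZMod d) →* Equiv.Perm (ℕ × ZMod d) where
  toFun e := mon 1 e.toAdd
  map_one' := mon_one
  map_mul' e f := by rw [mon_mul, toAdd_mul, add_comm]; rfl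

theorem mon_one_zpow (e : ℕ → ZMod d) (k : ℤ) : mon 1 e ^ k = mon 1 (k • e) :=
  (map_zpow (diagHom d) (Multiplicative.ofAdd e) k).symm

theorem tprod_mon (E : ℕ → ℕ → ZMod d) (e : ℕ → ℤ) (n : ℕ) :
    tprod (fun j => mon 1 (E j)) e n = mon 1 (∑ j ∈ Finset.Icc 1 n, e j • E j) := by
  induction n with
  | zero => simp [tprod, mon_one]
  | succ n ih =>
    rw [tprod, ih, mon_one_zpow, mon_mul, Finset.sum_Icc_succ_top (by omega), add_comm]
    rfl

theorem mon_conj (p : Equiv.Perm ℕ) (e : ℕ → ZMod d) :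
    (mon p 0)⁻¹ * mon 1 e * mon p 0 = mon 1 (e ∘ p) := by
  rw [mul_assoc, inv_mul_eq_iff_eq_mul, mon_mul, mon_mul]
  simp

theorem conjFam_mon {m j : ℕ} (hjm : j ≤ m + 1) :
    conjFam (permHom d ∘ adj) m (mon 1 (Pi.single (m + 1) 1)) j = mon 1 (Pi.single j 1) := by
  rw [conjFam, ← map_cyc]
  change (mon _ 0)⁻¹ * _ * mon _ 0 = _
  rw [mon_conj, mon_inj]
  refine ⟨rfl, funext fun a => ?_⟩
  rw [Function.comp_apply, Pi.single_apply, Pi.single_apply]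
  refine if_congr ?_ rfl rfl
  rw [← cyc_adj_apply_self hjm, (cyc adj m j).apply_eq_iff_eq]

end Model
end CRG

/-! ### Homomorphisms out of G(d,1,n) and its faithful monomial action -/

namespace CRG

theorem mk_eq_mk {α : Type} {R : FreeGroup α → FreeGroup α → Prop} {a b : FreeGroup α}
    (h : R a b) : PresentedGroup.mk (relators R) a = PresentedGroup.mk (relators R) b := by
  rw [← mul_inv_eq_one, ← map_inv, ← map_mul]
  exact (QuotientGroup.eq_one_iff _).2 (Subgroup.subset_normalClosure ⟨a, b, h, rfl⟩)

theorem exists_hom_of_rel {α : Type} {H : Type*} [Group H] {R : FreeGroup α → FreeGroup α → Prop}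
    (f : α → H) (hf : ∀ a b, R a b → FreeGroup.lift f a = FreeGroup.lift f b) :
    ∃ φ : PresentedGroup (relators R) →* H,
      ∀ w, φ (PresentedGroup.mk (relators R) w) = FreeGroup.lift f w := by
  have h : ∀ w ∈ relators R, FreeGroup.lift f w = 1 := by
    rintro _ ⟨a, b, hab, rfl⟩
    rw [map_mul, map_inv, hf a b hab, mul_inv_cancel]
  exact ⟨PresentedGroup.toGroup h, fun w => rfl⟩

theorem lift_x {H : Type*} [Group H] (f : ℕ → H) {n i : ℕ} (h1 : 1 ≤ i) (h2 : i ≤ n) :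
    FreeGroup.lift (fun a : Idx n => f a) (x n i) = f i := by
  simp [x, h1, h2]

section One

variable {G : Type*} [Group G]

/-- The elements `f 1, …, f n` satisfy the defining relations of `G(d,1,n)`. -/
structure SatOne (d n : ℕ) (f : ℕ → G) : Prop where
  typeA : TypeA f (n - 1)
  order : f n ^ d = 1
  comm : ∀ j, 1 ≤ j → j + 1 < n → f j * f n = f n * f j
  quad : f n * f (n - 1) * f n * f (n - 1) = f (n - 1) * f n * f (n - 1) * f n

variable {d n : ℕ}

theorem SatOne.exists_hom {f : ℕ → G} (h : SatOne d n f) :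
    ∃ φ : GOne d n →* G, ∀ i, 1 ≤ i → i ≤ n → φ (s d n i) = f i := by
  have key : ∀ a b, RelOne d n a b → FreeGroup.lift (fun a : Idx n => f a) a =
      FreeGroup.lift (fun a : Idx n => f a) b := by
    rintro _ _ (hn | ⟨i, h1, h2⟩ | ⟨i, j, h1, h2, h3⟩ | ⟨i, h1, h2⟩ | hn)
    · rw [map_pow, lift_x f hn le_rfl, h.order, map_one]
    · rw [map_pow, lift_x f h1 (by omega), sq, h.typeA.sq i h1 (by omega), map_one]
    · rw [map_mul, map_mul, lift_x f (by omega) h3, lift_x f h1 (by omega)]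
      rcases h3.eq_or_lt with rfl | h4
      · exact (h.comm j h1 h2).symm
      · exact h.typeA.comm i j h1 h2 (by omega)
    · simp only [map_mul]
      rw [lift_x f (by omega) (by omega), lift_x f h1 (by omega)]
      exact h.typeA.braid i h1 (by omega)
    · simp only [map_mul]
      rw [lift_x f (by omega) le_rfl, lift_x f (by omega) (by omega)]
      exact h.quad
  obtain ⟨φ, hφ⟩ := exists_hom_of_rel (fun a : Idx n => f a) key
  exact ⟨φ, fun i h1 h2 => (hφ _).trans (lift_x f h1 h2)⟩

theorem satOne_s (hn : 2 ≤ n) : SatOne d n (s d n) where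
  typeA :=
    { sq := fun i h1 h2 => by
        simpa [s, sq] using mk_eq_mk (RelOne.order (d := d) (n := n) i h1 (by omega))
      comm := fun i j h1 h2 h3 => by
        simpa [s] using mk_eq_mk (RelOne.comm (d := d) (n := n) i j h1 h2 (by omega))
      braid := fun i h1 h2 => by
        simpa [s] using mk_eq_mk (RelOne.braid (d := d) (n := n) i h1 (by omega)) }
  order := by simpa [s] using mk_eq_mk (RelOne.order_last (d := d) (n := n) (by omega))
  comm j h1 h2 := by
    simpa [s] using (mk_eq_mk (RelOne.comm (d := d) (n := n) n j h1 h2 le_rfl)).symm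
  quad := by simpa [s] using mk_eq_mk (RelOne.quad (d := d) (n := n) hn)

theorem closure_s : Subgroup.closure (s d n '' Set.Icc 1 n) = ⊤ := by
  rw [eq_top_iff, ← PresentedGroup.closure_range_of, Subgroup.closure_le]
  rintro _ ⟨⟨i, hi⟩, rfl⟩
  refine Subgroup.subset_closure ⟨i, hi, ?_⟩
  simp [s, x, hi, PresentedGroup.of]

theorem satOne_mon (hn : 2 ≤ n) :
    SatOne d n fun i => if i = n then mon (d := d) 1 (Pi.single n 1) else permHom d (adj i) where
  typeA := by
    have h := typeA_adj (n - 1)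
    have hne : ∀ i, i ≤ n - 1 → i ≠ n := by omega
    constructor
    · intro i h1 h2
      simp only [hne i h2, if_false]
      rw [← map_mul, h.sq i h1 h2, map_one]
    · intro i j h1 h2 h3
      simp only [hne i h3, hne j (by omega), if_false]
      rw [← map_mul, ← map_mul, h.comm i j h1 h2 h3]
    · intro i h1 h2
      simp only [hne i (by omega), hne (i + 1) h2, if_false]
      simp only [← map_mul]
      rw [h.braid i h1 h2]
  order := by
    rw [if_pos rfl, ← zpow_natCast, mon_one_zpow, ← mon_one, mon_inj]
    refine ⟨rfl, ?_⟩
    ext a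
    simp
  comm j h1 h2 := by
    rw [if_pos rfl, if_neg (by omega)]
    change mon _ 0 * mon _ _ = mon _ _ * mon _ 0
    rw [mon_mul, mon_mul, mon_inj]
    refine ⟨by simp, ?_⟩
    ext a
    have : adj j a = n ↔ a = n := by
      rw [adj, Equiv.swap_apply_def]
      split_ifs <;> omega
    simp [Pi.single_apply, this]
  quad := by
    rw [if_pos rfl, if_neg (by omega)]
    change mon _ _ * mon _ 0 * mon _ _ * mon _ 0 = mon _ 0 * mon _ _ * mon _ 0 * mon _ _
    simp only [mon_mul, mon_inj]
    refine ⟨by simp, ?_⟩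
    ext a
    have h1 : adj (n - 1) a = n ↔ a = n - 1 := by
      rw [adj, Equiv.swap_apply_def]
      split_ifs <;> omega
    have h2 : adj (n - 1) (adj (n - 1) a) = a := Equiv.swap_apply_self _ _ _
    simp [Pi.single_apply, h1, h2]
    exact add_comm _ _

/-- The action of `G(d,1,n)` by monomial permutations. -/
theorem exists_toMon (hn : 2 ≤ n) : ∃ ψ : GOne d n →* Equiv.Perm (ℕ × ZMod d),
    (∀ i, 1 ≤ i → i ≤ n - 1 → ψ (s d n i) = permHom d (adj i)) ∧
      ψ (s d n n) = mon 1 (Pi.single n 1) := by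
  obtain ⟨ψ, hψ⟩ := (satOne_mon (d := d) hn).exists_hom
  exact ⟨ψ, fun i h1 h2 => by rw [hψ i h1 (by omega), if_neg (by omega)],
    by rw [hψ n (by omega) le_rfl, if_pos rfl]⟩

/-- The total exponent of `s_n` modulo a divisor of `d`. -/
theorem exists_degree {r : ℕ} (hr : r ∣ d) : ∃ χ : GOne d n →* Multiplicative (ZMod r),
    (∀ i, 1 ≤ i → i ≤ n - 1 → χ (s d n i) = 1) ∧
      (2 ≤ n → χ (s d n n) = Multiplicative.ofAdd 1) := by
  have h : SatOne d n fun i => if i = n then Multiplicative.ofAdd (1 : ZMod r) else 1 := by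
    have hne : ∀ i, 1 ≤ i → i ≤ n - 1 → i ≠ n := by omega
    refine ⟨⟨fun i h1 h2 => ?_, fun i j _ _ _ => mul_comm _ _, fun i h1 h2 => ?_⟩, ?_,
      fun j _ _ => mul_comm _ _, ?_⟩
    · simp [hne i h1 h2]
    · simp [hne i h1 (by omega), hne (i + 1) (by omega) h2]
    · rw [if_pos rfl, ← ofAdd_nsmul, nsmul_one, (ZMod.natCast_eq_zero_iff d r).2 hr, ofAdd_zero]
    · simp only [mul_comm, mul_left_comm]
  obtain ⟨χ, hχ⟩ := h.exists_hom
  exact ⟨χ, fun i h1 h2 => by rw [hχ i h1 (by omega), if_neg (by omega)],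
    fun hn => by rw [hχ n (by omega) le_rfl, if_pos rfl]⟩

/-- The elements `t_j`, the conjugates of `s_n` in `G(d,1,n)`. -/
def t (d n j : ℕ) : GOne d n := conjFam (s d n) (n - 1) (s d n n) j

theorem t_top (hn : 2 ≤ n) : t d n n = s d n n := by
  have := conjFam_top (s := s d n) (m := n - 1) (t := s d n n)
  rwa [show n - 1 + 1 = n by omega] at this

theorem t_pred (hn : 2 ≤ n) : t d n (n - 1) = s d n (n - 1) * s d n n * s d n (n - 1) := by
  rw [t, conjFam, cyc_self, (satOne_s hn).typeA.inv (by omega) le_rfl]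

theorem comm_s_n (hn : 2 ≤ n) : ∀ i, 1 ≤ i → i + 1 ≤ n - 1 → s d n i * s d n n = s d n n * s d n i :=
  fun i h1 h2 => (satOne_s hn).comm i h1 (by omega)

theorem t_commute (hn : 2 ≤ n) {j k : ℕ} (hj : 1 ≤ j) (hjn : j ≤ n) (hk : 1 ≤ k) (hkn : k ≤ n) :
    Commute (t d n j) (t d n k) := by
  refine (satOne_s hn).typeA.conjFam_commute (comm_s_n hn) (fun _ => ?_) hj (by omega) hk (by omega)
  -- The relation of length four is exactly the commutation of t_n = s_n with t_{n-1} = s_{n-1} s_n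
  -- s_{n-1}.
  have h := (satOne_s (d := d) hn).quad
  change _ * t d n (n - 1) = t d n (n - 1) * _
  rw [t_pred hn]
  simpa only [mul_assoc] using h

theorem t_mul_s (hn : 2 ≤ n) {i j : ℕ} (hi : 1 ≤ i) (hin : i ≤ n - 1) (hj : 1 ≤ j) (hjn : j ≤ n) :
    t d n j * s d n i = s d n i * t d n (adj i j) :=
  (satOne_s hn).typeA.conjFam_mul (comm_s_n hn) hi hin hj (by omega)

theorem exists_nf_mul_tprod (hn : 2 ≤ n) (g : GOne d n) : ∃ i : ℕ → ℕ, (∀ p, 1 ≤ i p ∧ i p ≤ p + 1) ∧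
    ∃ e, g = nf (s d n) i (n - 1) * tprod (t d n) e n := by
  refine (satOne_s hn).typeA.exists_mul_tprod (T := t d n)
    (fun j k h1 h2 h3 h4 => t_commute hn h1 h2 h3 h4) ?_ ?_ g
  · intro i j h1 h2 h3 h4
    have := swap_succ_mem h1 h2 h3 (by omega)
    rw [mul_assoc, t_mul_s hn h1 h2 h3 h4, ← mul_assoc, (satOne_s hn).typeA.sq i h1 h2, one_mul]
    exact Subgroup.subset_closure ⟨_, ⟨this.1, this.2.trans (by omega)⟩, rfl⟩
  · rw [eq_top_iff, ← closure_s, Subgroup.closure_le]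
    rintro _ ⟨i, hi, rfl⟩
    rcases hi.2.eq_or_lt with rfl | hlt
    · exact Subgroup.mem_sup_right (Subgroup.subset_closure ⟨i, hi, t_top hn⟩)
    · exact Subgroup.mem_sup_left (mem_para hi.1 (by omega))

theorem toMon_cyc {ψ : GOne d n →* Equiv.Perm (ℕ × ZMod d)}
    (hs : ∀ i, 1 ≤ i → i ≤ n - 1 → ψ (s d n i) = permHom d (adj i)) {j : ℕ} (hj : 1 ≤ j) :
    ψ (cyc (s d n) (n - 1) j) = mon (cyc adj (n - 1) j) 0 := by
  rw [map_cyc, cyc_congr (s := ψ ∘ s d n) (s' := permHom d ∘ adj) hs hj, ← map_cyc]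
  rfl

theorem toMon_nf {ψ : GOne d n →* Equiv.Perm (ℕ × ZMod d)}
    (hs : ∀ i, 1 ≤ i → i ≤ n - 1 → ψ (s d n i) = permHom d (adj i)) {i : ℕ → ℕ}
    (hi : ∀ p, 1 ≤ i p) : ψ (nf (s d n) i (n - 1)) = mon (nf adj i (n - 1)) 0 := by
  rw [map_nf, nf_congr_left (s := ψ ∘ s d n) (s' := permHom d ∘ adj) hs hi, ← map_nf]
  rfl

theorem toMon_t {ψ : GOne d n →* Equiv.Perm (ℕ × ZMod d)}
    (hs : ∀ i, 1 ≤ i → i ≤ n - 1 → ψ (s d n i) = permHom d (adj i))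
    (ht : ψ (s d n n) = mon 1 (Pi.single n 1)) {j : ℕ} (hj : 1 ≤ j) (hjn : j ≤ n) :
    ψ (t d n j) = mon 1 (Pi.single j 1) := by
  have := conjFam_mon (d := d) (show j ≤ n - 1 + 1 by omega)
  rw [show n - 1 + 1 = n by omega] at this
  rw [t, map_conjFam, ht, ← this, conjFam, conjFam,
    cyc_congr (s := ψ ∘ s d n) (s' := permHom d ∘ adj) hs hj]

/-- On a kernel element in normal form, the trivial permutation kills the type A part, and the fibre
over j shows that d divides the exponent of t_j, whose d-th power is 1. -/
theorem toMon_injective (hn : 2 ≤ n) {ψ : GOne d n →* Equiv.Perm (ℕ × ZMod d)}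
    (hs : ∀ i, 1 ≤ i → i ≤ n - 1 → ψ (s d n i) = permHom d (adj i))
    (ht : ψ (s d n n) = mon 1 (Pi.single n 1)) : Function.Injective ψ := by
  refine (injective_iff_map_eq_one ψ).2 fun g hg => ?_
  obtain ⟨i, hi, e, rfl⟩ := exists_nf_mul_tprod hn g
  rw [map_mul, toMon_nf hs fun p => (hi p).1, map_tprod,
    tprod_congr_left (T := ψ ∘ t d n) (T' := fun j => mon 1 (Pi.single j 1)) fun j h1 h2 => toMon_t hs ht h1 h2,
    tprod_mon, mon_mul, ← mon_one, mon_inj] at hg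
  rw [nf_eq_one (by simpa using hg.1) hi, one_mul]
  refine tprod_eq_one fun j h1 h2 => ?_
  have h := congrFun hg.2 j
  have hd : (t d n j) ^ d = 1 := by
    rw [t, ← conjFam_pow, (satOne_s hn).order]
    simp [conjFam]
  have h' : ((e j : ℤ) : ZMod d) = 0 := by
    simpa [Finset.sum_apply, Pi.single_apply, h1, h2] using h
  obtain ⟨k, hk⟩ := (ZMod.intCast_zmod_eq_zero_iff_dvd _ _).1 h'
  rw [hk, zpow_mul, zpow_natCast, hd, one_zpow]

end One
end CRG

/-! ### Canonical words: existence, uniqueness and degree -/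

namespace CRG

section Exponents

variable {d : ℕ}

/-- The exponents of a list of pairs `(j, k)`, as a function of `j`. -/
def exps (d : ℕ) (l : List (ℕ × ℕ)) : ℕ → ZMod d :=
  (l.map fun a => Pi.single a.1 (a.2 : ZMod d)).sum

theorem exps_cons (a : ℕ × ℕ) (l : List (ℕ × ℕ)) :
    exps d (a :: l) = Pi.single a.1 (a.2 : ZMod d) + exps d l := by
  simp [exps]

theorem exps_eq_zero {l : List (ℕ × ℕ)} {j : ℕ} (h : ∀ a ∈ l, a.1 ≠ j) : exps d l j = 0 := by
  induction l with
  | nil => rfl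
  | cons a l ih =>
    rw [exps_cons, Pi.add_apply, ih fun b hb => h b (List.mem_cons_of_mem _ hb),
      Pi.single_eq_of_ne (h a List.mem_cons_self).symm, add_zero]

theorem exps_of_mem {l : List (ℕ × ℕ)} (hl : l.Pairwise fun a b => a.1 < b.1) {a : ℕ × ℕ}
    (ha : a ∈ l) : exps d l a.1 = a.2 := by
  induction l with
  | nil => simp at ha
  | cons b l ih =>
    rw [List.pairwise_cons] at hl
    rw [exps_cons, Pi.add_apply]
    rcases List.mem_cons.1 ha with rfl | ha
    · rw [Pi.single_eq_same, exps_eq_zero fun b hb => (hl.1 b hb).ne', add_zero]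
    · rw [Pi.single_eq_of_ne (hl.1 a ha).ne', zero_add, ih hl.2 ha]

/-- As 1 ≤ k ≤ d - 1, the number k is determined by its class modulo d, and this class is nonzero;
so the exponent function determines the list. -/
theorem mem_iff_exps (hd : 1 ≤ d) {l : List (ℕ × ℕ)} (hl : l.Pairwise fun a b => a.1 < b.1)
    (hk : ∀ a ∈ l, 1 ≤ a.2 ∧ a.2 ≤ d - 1) (a : ℕ × ℕ) :
    a ∈ l ↔ (1 ≤ a.2 ∧ a.2 ≤ d - 1) ∧ exps d l a.1 = a.2 := by
  refine ⟨fun ha => ⟨hk a ha, exps_of_mem hl ha⟩, fun ⟨h1, h2⟩ => ?_⟩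
  by_cases h : ∃ b ∈ l, b.1 = a.1
  · obtain ⟨b, hb, hba⟩ := h
    have h3 := exps_of_mem (d := d) hl hb
    rw [hba, h2, ZMod.natCast_eq_natCast_iff] at h3
    have h4 := hk b hb
    have := h3.eq_of_lt_of_lt (by omega) (by omega)
    rwa [show a = b from Prod.ext hba.symm this]
  · push Not at h
    rw [exps_eq_zero h] at h2
    have := Nat.le_of_dvd h1.1 ((ZMod.natCast_eq_zero_iff _ _).1 h2.symm)
    omega

theorem eq_of_exps_eq (hd : 1 ≤ d) {l l' : List (ℕ × ℕ)}
    (hl : l.Pairwise fun a b => a.1 < b.1) (hl' : l'.Pairwise fun a b => a.1 < b.1)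
    (hk : ∀ a ∈ l, 1 ≤ a.2 ∧ a.2 ≤ d - 1) (hk' : ∀ a ∈ l', 1 ≤ a.2 ∧ a.2 ≤ d - 1)
    (h : exps d l = exps d l') : l = l' := by
  have nodup : ∀ {l : List (ℕ × ℕ)}, l.Pairwise (fun a b => a.1 < b.1) → l.Nodup := fun h =>
    h.imp fun hab e => by simp [e] at hab
  refine List.Perm.eq_of_pairwise (fun a b _ _ h1 h2 => absurd h1 h2.asymm) hl hl'
    ((List.perm_ext_iff_of_nodup (nodup hl) (nodup hl')).2 fun a => ?_)
  rw [mem_iff_exps hd hl hk, mem_iff_exps hd hl' hk', h]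

/-- The list of pairs with given exponents. -/
def ofExps (n : ℕ) (e : ℕ → ZMod d) : List (ℕ × ℕ) :=
  ((List.range' 1 n).filter fun j => e j ≠ 0).map fun j => (j, (e j).val)

theorem mem_ofExps {n : ℕ} {e : ℕ → ZMod d} {a : ℕ × ℕ} :
    a ∈ ofExps n e ↔ (1 ≤ a.1 ∧ a.1 ≤ n) ∧ e a.1 ≠ 0 ∧ a.2 = (e a.1).val := by
  obtain ⟨j, k⟩ := a
  simp only [ofExps, List.mem_map, List.mem_filter, List.mem_range'_1, Prod.mk.injEq]
  constructor
  · rintro ⟨j, ⟨h1, h2⟩, rfl, rfl⟩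
    exact ⟨by omega, by simpa using h2, rfl⟩
  · rintro ⟨h1, h2, rfl⟩
    exact ⟨j, ⟨by omega, by simpa using h2⟩, rfl, rfl⟩

theorem pairwise_ofExps (n : ℕ) (e : ℕ → ZMod d) :
    (ofExps n e).Pairwise fun a b => a.1 < b.1 :=
  List.pairwise_map.2 ((List.pairwise_lt_range' (s := 1) (n := n)).filter _)

theorem exps_ofExps (hd : 1 ≤ d) {n j : ℕ} (e : ℕ → ZMod d) (hj : 1 ≤ j) (hjn : j ≤ n) :
    exps d (ofExps n e) j = e j := by
  have : NeZero d := ⟨by omega⟩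
  by_cases h : e j = 0
  · rw [h]
    refine exps_eq_zero fun a ha e' => (mem_ofExps.1 ha).2.1 (by rw [e', h])
  · have := exps_of_mem (d := d) (pairwise_ofExps n e)
      (mem_ofExps (a := (j, (e j).val)).2 ⟨⟨hj, hjn⟩, h, rfl⟩)
    simpa using this

end Exponents

section Words

variable {d n : ℕ}

namespace CanonicalWord

/-- The parameters `i_1, …, i_{n-1}` of a canonical word, as a function on `ℕ`. -/
def index (c : CanonicalWord d n) (q : ℕ) : ℕ :=
  -- The minimum matters only at q = 0, where q - 1 is also 0 and the parameter may be 2. It makes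
  -- the bound q + 1 hold for all q, as the normal form lemmas require.
  if h : q - 1 < n - 1 then min (c.i ⟨q - 1, h⟩) (q + 1) else 1

theorem index_bound (c : CanonicalWord d n) (q : ℕ) : 1 ≤ c.index q ∧ c.index q ≤ q + 1 := by
  unfold index
  split_ifs with h
  · have := c.one_le_i ⟨q - 1, h⟩
    omega
  · omega

theorem index_succ (c : CanonicalWord d n) (p : Fin (n - 1)) : c.index (p + 1) = c.i p := by
  have := c.i_le p
  rw [index, dif_pos (by simp)]
  simp only [Nat.add_sub_cancel, Fin.eta]
  omega

/-- The product of the elements `s_{n-1,j}` that occur in a canonical word. -/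
def cycProd {G : Type*} [Group G] (f : ℕ → G) (c : CanonicalWord d n) : G :=
  (c.jk.map fun a => cyc f (n - 1) a.1).prod

/-- The product of the powers of the elements `t_j` that occur in a canonical word. -/
def diagProd (c : CanonicalWord d n) : GOne d n := (c.jk.map fun a => t d n a.1 ^ a.2).prod

end CanonicalWord

/-- Each block s_n^k s_{n-1,j} is `cyc` times a power of t_j. As the j increase, t_j commutes with
all later `cyc` factors, so these can be collected on the left. -/
theorem prod_sPowWord (hn : 2 ≤ n) {l : List (ℕ × ℕ)} (hl : l.Pairwise fun a b => a.1 < b.1)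
    (hj : ∀ a ∈ l, 1 ≤ a.1 ∧ a.1 ≤ n) :
    (((l.map fun a => sPowWord n a.2 a.1).flatten).map (s d n)).prod =
      (l.map fun a => cyc (s d n) (n - 1) a.1).prod * (l.map fun a => t d n a.1 ^ a.2).prod := by
  induction l with
  | nil => simp
  | cons a l ih =>
    rw [List.pairwise_cons] at hl
    have h1 : ((sPowWord n a.2 a.1).map (s d n)).prod =
        cyc (s d n) (n - 1) a.1 * t d n a.1 ^ a.2 := by
      rw [t, ← conjFam_pow, cyc_mul_conjFam]
      simp [sPowWord, cyc]
    have h2 : Commute (t d n a.1 ^ a.2) (l.map fun a => cyc (s d n) (n - 1) a.1).prod := by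
      refine Commute.pow_left (Commute.list_prod_right (l.map fun a => cyc (s d n) (n - 1) a.1) _
        fun g hg => ?_) _
      obtain ⟨b, hb, rfl⟩ := List.mem_map.1 hg
      have hb' := hj b (List.mem_cons_of_mem _ hb)
      exact ((satOne_s hn).typeA.cyc_mul_conjFam_of_lt (comm_s_n hn)
        (hj a List.mem_cons_self).1 (hl.1 b hb) (by omega)).symm
    rw [List.map_cons, List.flatten_cons, List.map_append, List.prod_append, h1,
      ih hl.2 fun b hb => hj b (List.mem_cons_of_mem _ hb), List.map_cons, List.map_cons,
      List.prod_cons, List.prod_cons, mul_assoc, ← mul_assoc _ _ (List.prod _), h2.eq]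
    simp only [mul_assoc]

namespace CanonicalWord

theorem toGroup_eq (hn : 2 ≤ n) (c : CanonicalWord d n) :
    c.toGroup = nf (s d n) c.index (n - 1) * (c.cycProd (s d n) * c.diagProd) := by
  rw [toGroup, word, List.map_append, List.prod_append, prod_sPowWord hn c.j_lt c.j_mem,
    ← prod_flatten_ofFn]
  simp only [index_succ]
  rfl

theorem cycProd_mem (c : CanonicalWord d n) : c.cycProd (s d n) ∈ para (s d n) (n - 1) := by
  refine Subgroup.list_prod_mem _ fun g hg => ?_
  obtain ⟨a, ha, rfl⟩ := List.mem_map.1 hg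
  exact cyc_mem_para (c.j_mem a ha).1

theorem toMon_diagProd {ψ : GOne d n →* Equiv.Perm (ℕ × ZMod d)}
    (hs : ∀ i, 1 ≤ i → i ≤ n - 1 → ψ (s d n i) = permHom d (adj i))
    (ht : ψ (s d n n) = mon 1 (Pi.single n 1)) (c : CanonicalWord d n) :
    ψ c.diagProd = mon 1 (exps d c.jk) := by
  have h := c.j_mem
  rw [diagProd]
  generalize c.jk = l at h ⊢
  induction l with
  | nil => simp [exps, mon_one]
  | cons a l ih =>
    rw [List.map_cons, List.prod_cons, map_mul, ih fun b hb => h b (List.mem_cons_of_mem _ hb),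
      map_pow, toMon_t hs ht (h a List.mem_cons_self).1 (h a List.mem_cons_self).2,
      ← zpow_natCast, mon_one_zpow, mon_mul, exps_cons, add_comm, mul_one, ← Pi.single_smul]
    simp

theorem toMon_toGroup (hn : 2 ≤ n) {ψ : GOne d n →* Equiv.Perm (ℕ × ZMod d)}
    (hs : ∀ i, 1 ≤ i → i ≤ n - 1 → ψ (s d n i) = permHom d (adj i))
    (ht : ψ (s d n n) = mon 1 (Pi.single n 1)) (c : CanonicalWord d n) :
    ψ c.toGroup = mon (nf adj c.index (n - 1) * c.cycProd adj) (exps d c.jk) := by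
  have h : ψ (c.cycProd (s d n)) = mon (c.cycProd adj) 0 := by
    change _ = permHom d _
    rw [cycProd, cycProd, map_list_prod, map_list_prod, List.map_map, List.map_map]
    exact congrArg _ (List.map_congr_left fun a ha => toMon_cyc hs (c.j_mem a ha).1)
  rw [toGroup_eq hn, map_mul, map_mul, toMon_nf hs fun p => (c.index_bound p).1, h,
    toMon_diagProd hs ht, mon_mul, mon_mul, mon_inj]
  exact ⟨by simp, by ext; simp⟩

theorem toGroup_injective (hd : 1 ≤ d) (hn : 2 ≤ n) :
    Function.Injective (toGroup : CanonicalWord d n → GOne d n) := by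
  intro c c' h
  obtain ⟨ψ, hs, ht⟩ := exists_toMon (d := d) hn
  have h1 := congrArg ψ h
  rw [toMon_toGroup hn hs ht, toMon_toGroup hn hs ht, mon_inj] at h1
  have hjk := eq_of_exps_eq hd c.j_lt c'.j_lt c.k_mem c'.k_mem h1.2
  have h2 := h1.1
  rw [cycProd, cycProd, hjk] at h2
  have h3 := nf_adj_injective c.index_bound c'.index_bound (mul_right_cancel h2)
  refine CanonicalWord.ext (funext fun p => ?_) hjk
  rw [← index_succ, ← index_succ, h3 _ (by omega) p.2]

theorem toGroup_surjective (hd : 1 ≤ d) (hn : 2 ≤ n) :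
    Function.Surjective (toGroup : CanonicalWord d n → GOne d n) := by
  intro g
  have : NeZero d := ⟨by omega⟩
  obtain ⟨ψ, hs, ht⟩ := exists_toMon (d := d) hn
  obtain ⟨i, hi, e, rfl⟩ := exists_nf_mul_tprod hn g
  -- The diagonal part fixes the list of pairs, hence `cycProd`; the parameters i are placeholders
  -- here. The right ones come from the normal form of `nf` times the inverse of `cycProd`.
  let c₀ : CanonicalWord d n :=
    { i := fun _ => 1
      one_le_i := fun _ => le_rfl
      i_le := fun _ => by omega
      jk := ofExps n fun j => (e j : ZMod d)
      j_lt := pairwise_ofExps _ _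
      j_mem := fun a ha => (mem_ofExps.1 ha).1
      k_mem := fun a ha => by
        obtain ⟨-, h1, h2⟩ := mem_ofExps.1 ha
        have h3 := ZMod.val_lt (e a.1 : ZMod d)
        have h4 := (ZMod.val_ne_zero _).2 h1
        omega }
  obtain ⟨i', hi', h'⟩ := (satOne_s (d := d) hn).typeA.exists_nf
    (mul_mem (nf_mem_para fun p => (hi p).1) (inv_mem c₀.cycProd_mem))
  let c : CanonicalWord d n :=
    { c₀ with
      i := fun p => i' (p + 1)
      one_le_i := fun p => (hi' _).1
      i_le := fun p => (hi' _).2 }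
  have hc : nf (s d n) c.index (n - 1) = nf (s d n) i' (n - 1) := by
    refine nf_congr fun p h1 h2 => ?_
    obtain ⟨q, rfl⟩ : ∃ q, p = q + 1 := ⟨p - 1, by omega⟩
    exact c.index_succ ⟨q, by omega⟩
  refine ⟨c, ?_⟩
  have h1 : c.diagProd = tprod (t d n) e n := by
    refine toMon_injective hn hs ht ?_
    rw [toMon_diagProd hs ht, map_tprod,
      tprod_congr_left (T := ψ ∘ t d n) (T' := fun j => mon 1 (Pi.single j 1))
        fun j h1 h2 => toMon_t hs ht h1 h2, tprod_mon, mon_inj]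
    refine ⟨rfl, funext fun j => ?_⟩
    by_cases hj : 1 ≤ j ∧ j ≤ n
    · rw [exps_ofExps hd _ hj.1 hj.2]
      simp [Finset.sum_apply, Pi.single_apply, hj.1, hj.2]
    · rw [exps_eq_zero fun a ha e' => hj (by rw [← e']; exact (mem_ofExps.1 ha).1)]
      simp only [Finset.sum_apply, Pi.smul_apply, Pi.single_apply]
      refine (Finset.sum_eq_zero fun k hk => ?_).symm
      rw [Finset.mem_Icc] at hk
      rw [if_neg (by rintro rfl; exact hj hk), smul_zero]
  rw [toGroup_eq hn, hc, ← h', h1]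
  change _ * (c₀.cycProd (s d n) * _) = _
  group

theorem degree_toGroup (hn : 2 ≤ n) {r : ℕ} {χ : GOne d n →* Multiplicative (ZMod r)}
    (hs : ∀ i, 1 ≤ i → i ≤ n - 1 → χ (s d n i) = 1)
    (ht : χ (s d n n) = Multiplicative.ofAdd 1) (c : CanonicalWord d n) :
    χ c.toGroup = Multiplicative.ofAdd (c.kSum : ZMod r) := by
  have hpara : ∀ g ∈ para (s d n) (n - 1), χ g = 1 := by
    have : para (s d n) (n - 1) ≤ χ.ker := by
      refine (Subgroup.closure_le _).2 ?_
      rintro _ ⟨i, hi, rfl⟩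
      exact hs i hi.1 hi.2
    exact this
  have hD : χ c.diagProd = Multiplicative.ofAdd (c.kSum : ZMod r) := by
    have h := c.j_mem
    rw [diagProd, kSum]
    generalize c.jk = l at h ⊢
    induction l with
    | nil => simp
    | cons a l ih =>
      have h1 : χ (t d n a.1) = Multiplicative.ofAdd 1 := by
        rw [t, conjFam, map_mul, map_mul, map_inv, hpara _ (cyc_mem_para (h a List.mem_cons_self).1),
          ht, inv_one, one_mul, mul_one]
      rw [List.map_cons, List.prod_cons, map_mul, map_pow, h1,
        ih fun b hb => h b (List.mem_cons_of_mem _ hb), ← ofAdd_nsmul, ← ofAdd_add, nsmul_one,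
        List.map_cons, List.sum_cons, Nat.cast_add]
  rw [toGroup_eq hn, map_mul, map_mul, hpara _ (nf_mem_para fun p => (c.index_bound p).1),
    hpara _ c.cycProd_mem, one_mul, one_mul, hD]

/-- The elements whose canonical words have exponents that sum to a multiple of `r`. -/
theorem setOf_canonicalWords (hd : 1 ≤ d) (hn : 2 ≤ n) {r : ℕ}
    {χ : GOne d n →* Multiplicative (ZMod r)}
    (hs : ∀ i, 1 ≤ i → i ≤ n - 1 → χ (s d n i) = 1)
    (ht : χ (s d n n) = Multiplicative.ofAdd 1) :
    {g | ∃ c : CanonicalWord d n, c.toGroup = g ∧ c ∈ canonicalWords d r n} = (χ.ker : Set _) := by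
  have key : ∀ c : CanonicalWord d n, c ∈ canonicalWords d r n ↔ c.toGroup ∈ χ.ker := fun c => by
    rw [MonoidHom.mem_ker, degree_toGroup hn hs ht, ofAdd_eq_one, ZMod.natCast_eq_zero_iff,
      ← Nat.modEq_zero_iff_dvd]
    rfl
  ext g
  constructor
  · rintro ⟨c, rfl, hc⟩
    exact (key c).1 hc
  · intro hg
    obtain ⟨c, rfl⟩ := toGroup_surjective hd hn g
    exact ⟨c, rfl, (key c).2 hg⟩

end CanonicalWord
end Words
end CRG

/-! ### The relations of G(d,r,n) and their validity in G(d,1,n) -/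

namespace CRG

section Imprimitive

variable {G : Type*} [Group G] {d r n : ℕ}

/-- The elements `f 1, …, f n` and `z` satisfy the defining relations of `G(d,r,n)`. -/
structure SatR (d r n : ℕ) (f : ℕ → G) (z : G) : Prop where
  typeA : TypeA f (n - 1)
  sq_last : f n * f n = 1
  order_extra : z ^ (d / r) = 1
  comm_extra : ∀ j, 1 ≤ j → j + 2 ≤ n → f j * z = z * f j
  comm_last : ∀ j, 1 ≤ j → j + 3 ≤ n → f j * f n = f n * f j
  extra_comm : z * (f n * f (n - 1)) = f n * f (n - 1) * z
  braid_last : 3 ≤ n → f n * f (n - 2) * f n = f (n - 2) * f n * f (n - 2)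
  square : 3 ≤ n → (f n * f (n - 1) * f (n - 2)) ^ 2 = (f (n - 2) * f n * f (n - 1)) ^ 2
  extra_long : z * f n * (f (n - 1) * f n) ^ (r - 1) = f (n - 1) * z

namespace SatR

variable {f : ℕ → G} {z : G} (h : SatR d r n f z)
include h

theorem sq {i : ℕ} (h1 : 1 ≤ i) (h2 : i ≤ n) : f i * f i = 1 := by
  rcases h2.eq_or_lt with rfl | h2
  · exact h.sq_last
  · exact h.typeA.sq i h1 (by omega)

theorem conj_extra (hr : 1 ≤ r) :
    f (n - 1) * z * f (n - 1) = z * (f n * f (n - 1)) ^ r := by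
  obtain ⟨k, rfl⟩ := Nat.exists_eq_add_of_le' hr
  have h1 := h.extra_long
  rw [Nat.add_sub_cancel] at h1
  rw [← h1, mul_assoc, mul_pow_mul, pow_succ']
  simp only [mul_assoc]

/-- By `conj_extra`, z u^r with u = f n * f (n-1) is a conjugate of z, so its power d/r is 1; z
commutes with u, so this power is also z^{d/r} u^d = u^d. -/
theorem prod_pow (hn : 2 ≤ n) (hr : 1 ≤ r) (hrd : r ∣ d) : (f n * f (n - 1)) ^ d = 1 := by
  have hinv : (f (n - 1))⁻¹ = f (n - 1) := h.typeA.inv (by omega) le_rfl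
  have h1 : (z * (f n * f (n - 1)) ^ r) ^ (d / r) = 1 := by
    have h2 := conj_pow (i := d / r) (a := f (n - 1)) (b := z)
    rw [hinv] at h2
    rw [← h.conj_extra hr, h2, h.order_extra, mul_one, h.sq (by omega) (by omega)]
  have hc : Commute z ((f n * f (n - 1)) ^ r) := Commute.pow_right h.extra_comm r
  rwa [hc.mul_pow, h.order_extra, one_mul, ← pow_mul, Nat.mul_div_cancel' hrd] at h1

end SatR
end Imprimitive

/-- The elements of `G(d,1,n)` that correspond to the generators of `G(d,r,n)`. -/
def image (d n i : ℕ) : GOne d n :=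
  if i = n then s d n n ^ (d - 1) * s d n (n - 1) * s d n n else s d n i

section Image

variable {d r n : ℕ}

theorem image_last (hd : 1 ≤ d) (hn : 2 ≤ n) :
    image d n n = (s d n n)⁻¹ * s d n (n - 1) * s d n n := by
  rw [image, if_pos rfl, eq_inv_of_mul_eq_one_left (a := s d n n ^ (d - 1)) (b := s d n n)]
  rw [← pow_succ, Nat.sub_add_cancel hd, (satOne_s hn).order]

theorem image_of_lt {i : ℕ} (hi : i < n) : image d n i = s d n i := if_neg hi.ne

theorem image_mul (hd : 1 ≤ d) (hn : 2 ≤ n) :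
    image d n n * image d n (n - 1) = (t d n n)⁻¹ * t d n (n - 1) := by
  rw [image_last hd hn, image_of_lt (by omega), t_top hn, t_pred hn]
  simp only [mul_assoc]

theorem satR_image (hd : 1 ≤ d) (hn : 2 ≤ n) (hr : r ∣ d) :
    SatR d r n (image d n) (s d n n ^ r) := by
  have H := satOne_s (d := d) hn
  have hlt : ∀ i, i ≤ n - 1 → image d n i = s d n i := fun i hi => image_of_lt (by omega)
  have hl := image_last hd hn
  have htn := t_top (d := d) hn
  set c := s d n n with hcdef
  have hbb := H.typeA.sq (n - 1) (by omega) le_rfl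
  have hcomm : ∀ i, 1 ≤ i → i ≤ n - 2 → Commute (s d n i) c :=
    fun i h1 h2 => H.comm i h1 (by omega)
  have htt : Commute (t d n n) (t d n (n - 1)) :=
    t_commute hn (by omega) le_rfl (by omega) (by omega)
  have hu := image_mul hd hn
  constructor
  · refine ⟨fun i h1 h2 => ?_, fun i j h1 h2 h3 => ?_, fun i h1 h2 => ?_⟩
    · rw [hlt i h2]; exact H.typeA.sq i h1 h2
    · rw [hlt i h3, hlt j (by omega)]; exact H.typeA.comm i j h1 h2 h3
    · rw [hlt i (by omega), hlt (i + 1) h2]; exact H.typeA.braid i h1 h2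
  · rw [hl]
    calc _ = c⁻¹ * (s d n (n - 1) * s d n (n - 1)) * c := by group
      _ = 1 := by rw [hbb]; group
  · rw [← pow_mul, Nat.mul_div_cancel' hr, H.order]
  · intro j h1 h2
    rw [hlt j (by omega)]
    exact (hcomm j h1 (by omega)).pow_right r
  · intro j h1 h2
    rw [hlt j (by omega), hl]
    have h3 := hcomm j h1 (by omega)
    have h4 : Commute (s d n j) (s d n (n - 1)) :=
      (H.typeA.comm (n - 1) j h1 (by omega) le_rfl).symm
    exact (h3.inv_right.mul_right h4).mul_right h3
  · rw [hu, ← htn]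
    exact ((Commute.refl _).inv_right.mul_right htt).pow_left r
  · intro h3
    rw [hlt (n - 2) (by omega), hl]
    have hb := H.typeA.braid (n - 2) (by omega) (by omega)
    rw [show n - 2 + 1 = n - 1 by omega] at hb
    have hc := hcomm (n - 2) (by omega) le_rfl
    calc _ = c⁻¹ * s d n (n - 1) * (c * s d n (n - 2)) * c⁻¹ * s d n (n - 1) * c := by group
      _ = c⁻¹ * (s d n (n - 1) * s d n (n - 2) * s d n (n - 1)) * c := by rw [← hc.eq]; group
      _ = (c⁻¹ * s d n (n - 2)) * s d n (n - 1) * (s d n (n - 2) * c) := by rw [hb]; group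
      _ = _ := by rw [← hc.inv_right.eq, hc.eq]; group
  · intro h3
    have h1 : Commute (s d n (n - 2)) (t d n n) := by
      rw [htn]; exact hcomm (n - 2) (by omega) le_rfl
    have h2 := t_mul_s (d := d) (j := n - 1) hn (by omega : 1 ≤ n - 2) (by omega) (by omega)
      (by omega)
    rw [show adj (n - 2) (n - 1) = n - 2 by
      rw [adj, show n - 2 + 1 = n - 1 by omega, Equiv.swap_apply_right]] at h2
    have hcc := H.typeA.sq (n - 2) (by omega) (by omega)
    -- The relation `square` says that u commutes with its conjugate by s_{n-2}; here these elements
    -- are t_n⁻¹ t_{n-1} and t_n⁻¹ t_{n-2}.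
    have hv : s d n (n - 2) * ((t d n n)⁻¹ * t d n (n - 1)) * s d n (n - 2) =
        (t d n n)⁻¹ * t d n (n - 2) := by
      rw [← mul_assoc, h1.inv_right.eq, mul_assoc, h2, mul_assoc, ← mul_assoc _ _ (t d n (n - 2)),
        hcc, one_mul]
    have hT : ∀ j, 1 ≤ j → j ≤ n → ∀ k, 1 ≤ k → k ≤ n → Commute (t d n j) (t d n k) :=
      fun j a b k a' b' => t_commute hn a b a' b'
    have huv : Commute ((t d n n)⁻¹ * t d n (n - 1)) ((t d n n)⁻¹ * t d n (n - 2)) := by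
      refine Commute.mul_left (Commute.inv_left ?_) ?_ <;> refine Commute.mul_right
        (Commute.inv_right ?_) ?_ <;> exact hT _ (by omega) (by omega) _ (by omega) (by omega)
    rw [hu, hlt (n - 2) (by omega), mul_assoc _ (image d n n), hu, pow_two, pow_two,
      mul_assoc _ (s d n (n - 2)), ← mul_assoc (s d n (n - 2)) _ (s d n (n - 2)), hv, huv.eq, ← hv]
    simp only [mul_assoc]
  · obtain ⟨k, rfl⟩ : ∃ k, r = k + 1 :=
      Nat.exists_eq_add_of_le' (Nat.pos_of_dvd_of_pos hr hd)
    rw [Nat.add_sub_cancel, hlt (n - 1) le_rfl, hl]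
    set b := s d n (n - 1)
    -- With p = bcb = t_{n-1}, the product s̃_{n-1} s̃_n goes to p⁻¹c; since p and c commute, its
    -- k-th power splits into p⁻ᵏ and cᵏ.
    have hp : Commute (b * c * b) c := by
      rw [htn] at htt
      rw [← t_pred hn]
      exact htt.symm
    have h1 : b * (c⁻¹ * b * c) = (b * c * b)⁻¹ * c := by
      have : b⁻¹ = b := inv_eq_of_mul_eq_one_left hbb
      simp [mul_assoc, this]
    have h2 : ((b * c * b)⁻¹) ^ k = b * (c ^ k)⁻¹ * b := by
      have : b⁻¹ = b := inv_eq_of_mul_eq_one_left hbb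
      have h3 := conj_pow (i := k) (a := b) (b := c)
      rw [this] at h3
      rw [inv_pow, h3]
      simp [mul_assoc, this]
    rw [h1, hp.inv_left.mul_pow, h2]
    calc _ = c ^ k * (b * c * b) * (c ^ k)⁻¹ * b * c ^ k := by rw [pow_succ]; group
      _ = (b * c * b) * b * c ^ k := by
        rw [← (hp.pow_right k).eq]; group
      _ = b * c * (b * b) * c ^ k := by group
      _ = _ := by rw [hbb, pow_succ']; group

end Image
end CRG

/-! ### Injectivity and image of the map to G(d,1,n) -/

namespace CRG

section Injective

variable {G : Type*} [Group G] {d r n : ℕ}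

/-- The elements `u_1, …, u_{n-1}` that correspond to `t_n⁻¹ * t_j`, and `z`. -/
def diagFam (n : ℕ) (f : ℕ → G) (z : G) (j : ℕ) : G :=
  if j = n then z else conjFam f (n - 2) (f n * f (n - 1)) j

namespace SatR

variable {f : ℕ → G} {z : G}

theorem comm_prod (h : SatR d r n f z) :
    ∀ i, 1 ≤ i → i + 1 ≤ n - 2 → f i * (f n * f (n - 1)) = f n * f (n - 1) * f i := by
  intro i h1 h2
  have h3 : Commute (f i) (f n) := h.comm_last i h1 (by omega)
  have h4 : Commute (f i) (f (n - 1)) := (h.typeA.comm (n - 1) i h1 (by omega) le_rfl).symm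
  exact h3.mul_right h4

theorem conjFam_pred (h : SatR d r n f z) (hn : 3 ≤ n) :
    conjFam f (n - 2) (f n * f (n - 1)) (n - 2) = f (n - 2) * (f n * f (n - 1)) * f (n - 2) := by
  rw [conjFam, cyc_self, h.typeA.inv (by omega) (by omega)]

theorem conjFam_commute (h : SatR d r n f z) {j k : ℕ} (hj : 1 ≤ j) (hjn : j ≤ n - 1)
    (hk : 1 ≤ k) (hkn : k ≤ n - 1) :
    Commute (conjFam f (n - 2) (f n * f (n - 1)) j) (conjFam f (n - 2) (f n * f (n - 1)) k) := by
  refine (h.typeA.mono (by omega)).conjFam_commute h.comm_prod (fun hn => ?_) hj (by omega) hk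
    (by omega)
  -- With u = f n * f (n-1) and a = f (n-2), this reads uaua = auau: u commutes with aua.
  have h1 := h.square (by omega)
  rw [pow_two, pow_two] at h1
  rw [h.conjFam_pred (by omega)]
  simp only [Commute, SemiconjBy, mul_assoc] at h1 ⊢
  exact h1

theorem commute_extra (h : SatR d r n f z) {j : ℕ} (hj : 1 ≤ j) :
    Commute z (conjFam f (n - 2) (f n * f (n - 1)) j) := by
  have h1 : Commute (cyc f (n - 2) j) z :=
    commute_of_mem_para (fun i h1 h2 => h.comm_extra i h1 (by omega)) (cyc_mem_para hj)
  exact (h1.symm.inv_right.mul_right h.extra_comm).mul_right h1.symm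

theorem diagFam_commute (h : SatR d r n f z) {j k : ℕ} (hj : 1 ≤ j) (hjn : j ≤ n) (hk : 1 ≤ k)
    (hkn : k ≤ n) : Commute (diagFam n f z j) (diagFam n f z k) := by
  unfold diagFam
  split_ifs
  · exact Commute.refl _
  · exact h.commute_extra hk
  · exact (h.commute_extra hj).symm
  · exact h.conjFam_commute hj (by omega) hk (by omega)

theorem diagFam_of_lt {j : ℕ} (hj : j < n) :
    diagFam n f z j = conjFam f (n - 2) (f n * f (n - 1)) j := if_neg hj.ne

theorem diagFam_pred (hn : 2 ≤ n) : diagFam n f z (n - 1) = f n * f (n - 1) := by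
  have := conjFam_top (s := f) (m := n - 2) (t := f n * f (n - 1))
  rw [show n - 2 + 1 = n - 1 by omega] at this
  rw [diagFam_of_lt (by omega), this]

theorem diagFam_last : diagFam n f z n = z := if_pos rfl

/-- For i ≤ n-2, `f i` fixes z and permutes the u_j. The element `f (n-1)` sends z to z u^r, inverts
u = u_{n-1}, and sends u_j to u⁻¹ u_j for j < n-1, as the swap of t_{n-1} and t_n would. -/
theorem conj_diagFam_mem (h : SatR d r n f z) (hn : 2 ≤ n) (hr : 1 ≤ r) {i j : ℕ} (hi : 1 ≤ i)
    (hin : i ≤ n - 1) (hj : 1 ≤ j) (hjn : j ≤ n) :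
    f i * diagFam n f z j * f i ∈ Subgroup.closure (diagFam n f z '' Set.Icc 1 n) := by
  have mem : ∀ k, 1 ≤ k → k ≤ n →
      diagFam n f z k ∈ Subgroup.closure (diagFam n f z '' Set.Icc 1 n) :=
    fun k h1 h2 => Subgroup.subset_closure ⟨k, ⟨h1, h2⟩, rfl⟩
  have hz := mem n (by omega) le_rfl
  have hu := mem (n - 1) (by omega) (by omega)
  rw [diagFam_last] at hz
  rw [diagFam_pred hn] at hu
  have hsq := h.typeA.sq i hi hin
  have hinv := h.typeA.inv hi hin
  rcases hjn.eq_or_lt with rfl | hjn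
  · rw [diagFam_last]
    rcases hin.eq_or_lt with rfl | hin
    · rw [h.conj_extra hr]
      exact mul_mem hz (pow_mem hu r)
    · rw [h.comm_extra i hi (by omega), mul_assoc, hsq, mul_one]
      exact hz
  have hA := h.typeA.mono (by omega : n - 2 ≤ n - 1)
  rcases hin.eq_or_lt with rfl | hin'
  · rcases (Nat.le_sub_one_of_lt hjn).eq_or_lt with rfl | hjn'
    · rw [diagFam_pred hn, mul_assoc, mul_assoc, hsq, mul_one]
      have : f (n - 1) * f n = (f n * f (n - 1))⁻¹ := by
        rw [mul_inv_rev, hinv, inv_eq_of_mul_eq_one_left h.sq_last]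
      rw [this]
      exact inv_mem hu
    · have key : f (n - 1) * conjFam f (n - 2) (f n * f (n - 1)) j =
          (f n * f (n - 1))⁻¹ * conjFam f (n - 2) (f n * f (n - 1)) j * f (n - 1) := by
        refine hA.mul_conjFam h.comm_prod ?_ ?_ ?_ hj (by omega)
        · intro i h1 h2
          exact (h.typeA.comm (n - 1) i h1 (by omega) le_rfl).symm
        · intro i h1 h2
          exact (Commute.inv_right (h.comm_prod i h1 h2) :)
        -- The case j = n-2, to which `mul_conjFam` reduces all smaller j; it follows from the two
        -- braid relations of f (n-2), with f n and with f (n-1).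
        · have hcc := h.typeA.sq (n - 2) (by omega) (by omega)
          have h1 := h.braid_last (by omega)
          have h2 := h.typeA.braid (n - 2) (by omega) (by omega)
          rw [show n - 2 + 1 = n - 1 by omega] at h2
          rw [h.conjFam_pred (by omega), mul_inv_rev, hinv, inv_eq_of_mul_eq_one_left h.sq_last]
          symm
          calc _ = f (n - 1) * (f n * f (n - 2) * f n) * (f (n - 1) * f (n - 2) * f (n - 1)) := by
                group
            _ = f (n - 1) * f (n - 2) * f n * (f (n - 2) * f (n - 2)) * f (n - 1) * f (n - 2) := by
                rw [h1, h2]; group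
            _ = _ := by rw [hcc]; group
      rw [diagFam_of_lt hjn, key, mul_assoc, hsq, mul_one, ← diagFam_of_lt (z := z) hjn]
      exact mul_mem (inv_mem hu) (mem j hj hjn.le)
  · have := swap_succ_mem hi (by omega : i ≤ n - 2) hj (by omega)
    rw [diagFam_of_lt hjn, mul_assoc, hA.conjFam_mul h.comm_prod hi (by omega) hj (by omega),
      ← mul_assoc, hsq, one_mul, ← diagFam_of_lt (z := z) (by omega)]
    exact mem _ this.1 (by omega)

theorem diagFam_pow (h : SatR d r n f z) (hn : 2 ≤ n) (hr : 1 ≤ r) (hrd : r ∣ d) {j : ℕ}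
    (hj : j < n) : diagFam n f z j ^ d = 1 := by
  rw [diagFam_of_lt hj, ← conjFam_pow, h.prod_pow hn hr hrd]
  simp [conjFam]

theorem exists_nf_mul_tprod (h : SatR d r n f z) (hn : 2 ≤ n) (hr : 1 ≤ r)
    (hgen : Subgroup.closure (insert z (f '' Set.Icc 1 n)) = ⊤) (g : G) :
    ∃ i : ℕ → ℕ, (∀ p, 1 ≤ i p ∧ i p ≤ p + 1) ∧
      ∃ e, g = nf f i (n - 1) * tprod (diagFam n f z) e n := by
  refine h.typeA.exists_mul_tprod (fun j k h1 h2 h3 h4 => h.diagFam_commute h1 h2 h3 h4)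
    (fun i j h1 h2 h3 h4 => h.conj_diagFam_mem hn hr h1 h2 h3 h4) ?_ g
  have mem : ∀ k, 1 ≤ k → k ≤ n → diagFam n f z k ∈
      para f (n - 1) ⊔ Subgroup.closure (diagFam n f z '' Set.Icc 1 n) :=
    fun k h1 h2 => Subgroup.mem_sup_right (Subgroup.subset_closure ⟨k, ⟨h1, h2⟩, rfl⟩)
  have mem' : ∀ k, 1 ≤ k → k ≤ n - 1 → f k ∈
      para f (n - 1) ⊔ Subgroup.closure (diagFam n f z '' Set.Icc 1 n) :=
    fun k h1 h2 => Subgroup.mem_sup_left (mem_para h1 h2)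
  rw [eq_top_iff, ← hgen, Subgroup.closure_le]
  rintro _ (rfl | ⟨i, hi, rfl⟩)
  · have := mem n (by omega) le_rfl
    rwa [diagFam_last] at this
  · rcases hi.2.eq_or_lt with rfl | hlt
    · have h1 := mem (i - 1) (by omega) (by omega)
      have h2 := mem' (i - 1) (by omega) le_rfl
      rw [diagFam_pred hn] at h1
      have h3 := mul_mem h1 h2
      rwa [mul_assoc, h.typeA.sq _ (by omega) le_rfl, mul_one] at h3
    · exact mem' i hi.1 (by omega)

theorem injective_of_image (h : SatR d r n f z) (hd : 1 ≤ d) (hn : 2 ≤ n) (hrd : r ∣ d)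
    (hgen : Subgroup.closure (insert z (f '' Set.Icc 1 n)) = ⊤) {τ : G →* GOne d n}
    (hz : τ z = s d n n ^ r) (hf : ∀ i, 1 ≤ i → i ≤ n → τ (f i) = image d n i) :
    Function.Injective τ := by
  have hr : 1 ≤ r := Nat.pos_of_dvd_of_pos hrd hd
  obtain ⟨ψ, hs, ht⟩ := exists_toMon (d := d) hn
  have hfs : ∀ i, 1 ≤ i → i ≤ n - 1 → (ψ.comp τ) (f i) = permHom d (adj i) := fun i h1 h2 => by
    rw [MonoidHom.comp_apply, hf i h1 (by omega), image_of_lt (by omega), hs i h1 h2]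
  have hlast : (ψ.comp τ) z = mon 1 (r • Pi.single n 1) := by
    rw [MonoidHom.comp_apply, hz, map_pow, ht, ← zpow_natCast, mon_one_zpow, natCast_zsmul]
  have hu : (ψ.comp τ) (f n * f (n - 1)) = mon 1 (Pi.single (n - 1) 1 - Pi.single n 1) := by
    rw [MonoidHom.comp_apply, map_mul, hf n (by omega) le_rfl, hf (n - 1) (by omega) (by omega),
      image_mul hd hn, map_mul, map_inv, toMon_t hs ht (by omega) le_rfl,
      toMon_t hs ht (by omega) (by omega), inv_mul_eq_iff_eq_mul, mon_mul, mon_inj]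
    exact ⟨by simp, by simp⟩
  have hV : ∀ j, 1 ≤ j → j < n →
      (ψ.comp τ) (diagFam n f z j) = mon 1 (Pi.single j 1 - Pi.single n 1) := fun j h1 h2 => by
    rw [diagFam_of_lt h2, map_conjFam, hu, conjFam,
      cyc_congr (s := ψ.comp τ ∘ f) (s' := permHom d ∘ adj) (fun p h1 h2 => hfs p h1 (by omega)) h1,
      ← map_cyc]
    change (mon _ 0)⁻¹ * _ * mon _ 0 = _
    rw [mon_conj, mon_inj]
    refine ⟨rfl, funext fun a => ?_⟩
    have e1 : cyc adj (n - 2) j a = n - 1 ↔ a = j := by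
      have := cyc_adj_apply_self (show j ≤ n - 2 + 1 by omega)
      rw [show n - 1 = n - 2 + 1 by omega, ← this, (cyc adj (n - 2) j).apply_eq_iff_eq]
    have e2 : cyc adj (n - 2) j a = n ↔ a = n := by
      have := apply_of_mem_para_adj (show n - 2 + 1 < n by omega) (cyc_mem_para h1)
      exact ⟨fun h => (cyc adj (n - 2) j).injective (h.trans this.symm), fun h => by rw [h, this]⟩
    simp [Pi.single_apply, e1, e2]
  refine (injective_iff_map_eq_one τ).2 fun g hg => ?_
  obtain ⟨i, hi, e, rfl⟩ := h.exists_nf_mul_tprod hn hr hgen g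
  replace hg := congrArg ψ hg
  rw [← MonoidHom.comp_apply, map_mul, map_nf,
    nf_congr_left (s := ψ.comp τ ∘ f) (s' := permHom d ∘ adj) hfs fun p => (hi p).1, ← map_nf,
    map_tprod, tprod_congr_left (T := ψ.comp τ ∘ diagFam n f z)
      (T' := fun j => mon 1 (if j = n then r • Pi.single n 1 else Pi.single j 1 - Pi.single n 1)) ?_,
    tprod_mon, map_one] at hg
  · change mon _ 0 * _ = _ at hg
    rw [mon_mul, ← mon_one, mon_inj] at hg
    rw [nf_eq_one (by simpa using hg.1) hi, one_mul]
    have hsum := hg.2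
    obtain ⟨m, rfl⟩ : ∃ m, n = m + 1 := ⟨n - 1, by omega⟩
    have hE : ∀ j ∈ Finset.Icc 1 m, (e j • if j = m + 1 then r • Pi.single (m + 1) 1 else
        Pi.single j 1 - Pi.single (m + 1) 1 : ℕ → ZMod d) =
        e j • (Pi.single j 1 - Pi.single (m + 1) 1) := fun j hj => by
      rw [if_neg (show j ≠ m + 1 by have := (Finset.mem_Icc.1 hj).2; omega)]
    rw [Finset.sum_Icc_succ_top (by omega), if_pos rfl, Finset.sum_congr rfl hE] at hsum
    have hsum' : ∀ k, ∑ j ∈ Finset.Icc 1 m, ((e j : ZMod d) *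
        ((if k = j then 1 else 0) - (if k = m + 1 then 1 else 0))) +
        (e (m + 1) : ZMod d) * (r * if k = m + 1 then 1 else 0) = 0 := fun k => by
      refine Eq.trans ?_ (congrFun hsum k)
      simp [Finset.sum_apply, Pi.single_apply]
    -- For j ≤ m, coordinate j sees only e j. Once these vanish modulo d, coordinate m+1 leaves r *
    -- e (m+1), so d/r divides e (m+1), matching the order relation of z.
    have he : ∀ j, 1 ≤ j → j ≤ m → (e j : ZMod d) = 0 := fun j h1 h2 => by
      have := hsum' j
      simpa [h1, h2, show j ≠ m + 1 by omega] using this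
    have hlast : (e (m + 1) : ZMod d) * r = 0 := by
      have := hsum' (m + 1)
      rw [Finset.sum_eq_zero] at this
      · simpa using this
      · intro j hj
        rw [Finset.mem_Icc] at hj
        rw [he j hj.1 hj.2, zero_mul]
    refine tprod_eq_one fun j h1 h2 => ?_
    rcases h2.eq_or_lt with rfl | h2
    · have h3 : ((e (m + 1) * r : ℤ) : ZMod d) = 0 := by exact_mod_cast hlast
      rw [ZMod.intCast_zmod_eq_zero_iff_dvd] at h3
      obtain ⟨q, rfl⟩ := hrd
      rw [Nat.cast_mul, mul_comm] at h3
      obtain ⟨k, hk⟩ := Int.dvd_of_mul_dvd_mul_right (by omega) h3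
      have h4 := h.order_extra
      rw [Nat.mul_div_cancel_left q hr] at h4
      rw [diagFam_last, hk, zpow_mul, zpow_natCast, h4, one_zpow]
    · obtain ⟨k, hk⟩ := (ZMod.intCast_zmod_eq_zero_iff_dvd _ _).1 (he j h1 (by omega))
      rw [hk, zpow_mul, zpow_natCast, h.diagFam_pow hn hr hrd h2, one_zpow]
  · intro j h1 h2
    rcases h2.eq_or_lt with rfl | h2
    · rw [if_pos rfl, Function.comp_apply, diagFam_last, hlast]
    · rw [if_neg h2.ne, Function.comp_apply, hV j h1 h2]

end SatR

/-- A subgroup of `G(d,1,n)` that contains the images of the generators of `G(d,r,n)` contains all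
elements of degree divisible by `r`. -/
theorem ker_degree_le (hd : 1 ≤ d) (hn : 2 ≤ n) {χ : GOne d n →* Multiplicative (ZMod r)}
    (ht : χ (s d n n) = Multiplicative.ofAdd 1) {R : Subgroup (GOne d n)} (hR : R ≤ χ.ker)
    (hz : s d n n ^ r ∈ R) (hf : ∀ i, 1 ≤ i → i ≤ n → image d n i ∈ R) : χ.ker ≤ R := by
  have H := satOne_s (d := d) hn
  -- The union of the cosets R s_nᵏ is stable under right multiplication by the generators and their
  -- inverses.
  have key : ∀ g : GOne d n, ∃ ρ ∈ R, ∃ k : ℤ, g = ρ * s d n n ^ k := by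
    intro g
    have hg : g ∈ Subgroup.closure (s d n '' Set.Icc 1 n) := closure_s ▸ Subgroup.mem_top g
    have step : ∀ i, 1 ≤ i → i ≤ n - 1 → ∀ g : GOne d n, (∃ ρ ∈ R, ∃ k : ℤ, g = ρ * s d n n ^ k) →
        ∃ ρ ∈ R, ∃ k : ℤ, g * s d n i = ρ * s d n n ^ k := by
      rintro i h1 h2 _ ⟨ρ, hρ, k, rfl⟩
      have hi := hf i h1 (by omega)
      rw [image_of_lt (by omega)] at hi
      rcases h2.eq_or_lt with rfl | h2
      · have hu := mul_mem (hf n (by omega) le_rfl) (hf (n - 1) (by omega) (by omega))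
        rw [image_mul hd hn] at hu
        have hc : Commute (t d n n)⁻¹ (t d n (n - 1)) :=
          (t_commute hn (by omega) le_rfl (by omega) (by omega)).inv_left
        -- The witness comes from s_nᵏ s_{n-1} = s_{n-1} t_{n-1}ᵏ = s_{n-1} (t_n⁻¹ t_{n-1})ᵏ s_nᵏ,
        -- where t_n⁻¹ t_{n-1} is the image of u and lies in R.
        refine ⟨ρ * s d n (n - 1) * ((t d n n)⁻¹ * t d n (n - 1)) ^ k,
          mul_mem (mul_mem hρ hi) (zpow_mem hu k), k, ?_⟩
        have e1 : t d n (n - 1) ^ k = s d n (n - 1) * s d n n ^ k * s d n (n - 1) := by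
          have hinv := H.typeA.inv (show 1 ≤ n - 1 by omega) le_rfl
          have := conj_zpow (i := k) (a := s d n (n - 1)) (b := s d n n)
          rw [hinv] at this
          rw [t_pred hn, this]
        rw [hc.eq, hc.symm.mul_zpow, e1, t_top hn]
        calc _ = ρ * (1 * s d n n ^ k * s d n (n - 1)) := by group
          _ = _ := by rw [← H.typeA.sq (n - 1) (by omega) le_rfl]; group
      · refine ⟨ρ * s d n i, mul_mem hρ hi, k, ?_⟩
        have : Commute (s d n i) (s d n n ^ k) := Commute.zpow_right (H.comm i h1 (by omega)) k
        rw [mul_assoc, mul_assoc, this.eq]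
    induction hg using Subgroup.closure_induction_right with
    | one => exact ⟨1, one_mem _, 0, by simp⟩
    | mul_right x _ y hy ih =>
      obtain ⟨i, hi, rfl⟩ := hy
      rcases hi.2.eq_or_lt with rfl | hlt
      · obtain ⟨ρ, hρ, k, rfl⟩ := ih
        exact ⟨ρ, hρ, k + 1, by rw [mul_assoc, zpow_add_one]⟩
      · exact step i hi.1 (by omega) x ih
    | mul_inv_cancel x _ y hy ih =>
      obtain ⟨i, hi, rfl⟩ := hy
      rcases hi.2.eq_or_lt with rfl | hlt
      · obtain ⟨ρ, hρ, k, rfl⟩ := ih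
        exact ⟨ρ, hρ, k - 1, by rw [mul_assoc, zpow_sub_one]⟩
      · rw [H.typeA.inv hi.1 (by omega)]
        exact step i hi.1 (by omega) x ih
  intro g hg
  obtain ⟨ρ, hρ, k, rfl⟩ := key g
  rw [MonoidHom.mem_ker, map_mul, hR hρ, one_mul, map_zpow, ht, ← ofAdd_zsmul, ofAdd_eq_one,
    zsmul_one, ZMod.intCast_zmod_eq_zero_iff_dvd] at hg
  obtain ⟨l, rfl⟩ := hg
  refine mul_mem hρ ?_
  rw [zpow_mul, zpow_natCast]
  exact zpow_mem hz l

theorem SatR.range_of_image {f : ℕ → G} {z : G} (hd : 1 ≤ d) (hn : 2 ≤ n)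
    (hrd : r ∣ d) (hgen : Subgroup.closure (insert z (f '' Set.Icc 1 n)) = ⊤) {τ : G →* GOne d n}
    (hz : τ z = s d n n ^ r) (hf : ∀ i, 1 ≤ i → i ≤ n → τ (f i) = image d n i) :
    Set.range τ =
      {g | ∃ c : CanonicalWord d n, c.toGroup = g ∧ c ∈ canonicalWords d r n} := by
  obtain ⟨χ, hs, ht⟩ := exists_degree (n := n) hrd
  replace ht := ht hn
  rw [CanonicalWord.setOf_canonicalWords hd hn hs ht, ← MonoidHom.coe_range, SetLike.coe_set_eq]
  have hle : τ.range ≤ χ.ker := by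
    rw [MonoidHom.range_eq_map, ← hgen, MonoidHom.map_closure, Subgroup.closure_le]
    rintro _ ⟨_, rfl | ⟨i, hi, rfl⟩, rfl⟩
    · rw [hz, SetLike.mem_coe, MonoidHom.mem_ker, map_pow, ht, ← ofAdd_nsmul]
      simp
    · rw [hf i hi.1 hi.2, SetLike.mem_coe, MonoidHom.mem_ker]
      rcases hi.2.eq_or_lt with rfl | hlt
      · rw [image_last hd hn, map_mul, map_mul, hs _ (by omega) le_rfl, map_inv]
        simp
      · rw [image_of_lt hlt, hs i hi.1 (by omega)]
  exact le_antisymm hle (ker_degree_le hd hn ht hle ⟨z, hz⟩ fun i h1 h2 => ⟨f i, hf i h1 h2⟩)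

end Injective
end CRG

/-! ### The presentations of G(d,r,n) and G(d,d,n)' -/

namespace CRG

/-- The map from the generators of `G(d,r,n)` given by `f 1, …, f n` and `z₀`. -/
def genMap {H : Type*} (f : ℕ → H) (z₀ : H) (n : ℕ) : Gen n → H
  | Gen.idx i => f i
  | Gen.extra => z₀

theorem lift_y {H : Type*} [Group H] (f : ℕ → H) (z₀ : H) {n i : ℕ} (h1 : 1 ≤ i) (h2 : i ≤ n) :
    FreeGroup.lift (genMap f z₀ n) (y n i) = f i := by
  simp [y, h1, h2, genMap]

theorem lift_z {H : Type*} [Group H] (f : ℕ → H) (z₀ : H) {n : ℕ} :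
    FreeGroup.lift (genMap f z₀ n) (z n) = z₀ := by
  simp [z, genMap]

section Presentations

variable {G : Type*} [Group G] {d r n : ℕ}

theorem SatR.exists_hom {f : ℕ → G} {z₀ : G} (h : SatR d r n f z₀) :
    ∃ φ : GR d r n →* G, φ (sExtra d r n) = z₀ ∧ ∀ i, 1 ≤ i → i ≤ n → φ (sR d r n i) = f i := by
  have key : ∀ a b, RelR d r n a b →
      FreeGroup.lift (genMap f z₀ n) a =
        FreeGroup.lift (genMap f z₀ n) b := by
    rintro _ _ (_ | ⟨i, h1, h2⟩ | ⟨i, j, h1, h2, h3⟩ | ⟨j, h1, h2⟩ | ⟨j, h1, h2⟩ | ⟨i, h1, h2⟩ |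
      hn | hn | hn | hn) <;> simp only [map_mul, map_pow, map_one, lift_z]
    · exact h.order_extra
    · rw [lift_y f z₀ h1 h2, pow_two, h.sq h1 h2]
    · rw [lift_y f z₀ (by omega) (by omega), lift_y f z₀ (by omega) (by omega)]
      exact h.typeA.comm i j h1 h2 (by omega)
    · rw [lift_y f z₀ (by omega) (by omega)]
      exact (h.comm_extra j h1 h2).symm
    · rw [lift_y f z₀ (by omega) (by omega), lift_y f z₀ (by omega) (by omega)]
      exact (h.comm_last j h1 h2).symm
    · rw [lift_y f z₀ (by omega) (by omega), lift_y f z₀ (by omega) (by omega)]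
      exact h.typeA.braid i h1 (by omega)
    · rw [lift_y f z₀ (by omega) (by omega), lift_y f z₀ (by omega) (by omega), mul_assoc]
      exact h.extra_comm
    · rw [lift_y f z₀ (by omega) (by omega), lift_y f z₀ (by omega) (by omega)]
      exact h.braid_last hn
    · rw [lift_y f z₀ (by omega) (by omega), lift_y f z₀ (by omega) (by omega),
        lift_y f z₀ (by omega) (by omega)]
      exact h.square hn
    · rw [lift_y f z₀ (by omega) (by omega), lift_y f z₀ (by omega) (by omega)]
      exact h.extra_long
  obtain ⟨φ, hφ⟩ := exists_hom_of_rel _ key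
  exact ⟨φ, (hφ _).trans (lift_z f z₀), fun i h1 h2 => (hφ _).trans (lift_y f z₀ h1 h2)⟩

theorem SatR.exists_hom_GD {f : ℕ → G} {z₀ : G} (h : SatR d r n f z₀) (hr : 1 ≤ r) (hrd : r ∣ d) :
    ∃ φ : GD d n →* G, ∀ i, 1 ≤ i → i ≤ n → φ (sD d n i) = f i := by
  have key : ∀ a b, RelD d n a b →
      FreeGroup.lift (fun a : Idx n => f a) a = FreeGroup.lift (fun a : Idx n => f a) b := by
    rintro _ _ (⟨i, h1, h2⟩ | hn | ⟨i, j, h1, h2, h3⟩ | ⟨j, h1, h2⟩ | ⟨i, h1, h2⟩ | hn | hn) <;>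
      simp only [map_mul, map_pow, map_one]
    · rw [lift_x f h1 h2, pow_two, h.sq h1 h2]
    · rw [lift_x f (by omega) (by omega), lift_x f (by omega) (by omega)]
      exact h.prod_pow hn hr hrd
    · rw [lift_x f (by omega) (by omega), lift_x f (by omega) (by omega)]
      exact h.typeA.comm i j h1 h2 (by omega)
    · rw [lift_x f (by omega) (by omega), lift_x f (by omega) (by omega)]
      exact (h.comm_last j h1 h2).symm
    · rw [lift_x f (by omega) (by omega), lift_x f (by omega) (by omega)]
      exact h.typeA.braid i h1 (by omega)
    · rw [lift_x f (by omega) (by omega), lift_x f (by omega) (by omega)]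
      exact h.braid_last hn
    · rw [lift_x f (by omega) (by omega), lift_x f (by omega) (by omega),
        lift_x f (by omega) (by omega)]
      exact h.square hn
  obtain ⟨φ, hφ⟩ := exists_hom_of_rel _ key
  exact ⟨φ, fun i h1 h2 => (hφ _).trans (lift_x f h1 h2)⟩

theorem satR_sR (hn : 2 ≤ n) : SatR d r n (sR d r n) (sExtra d r n) where
  typeA :=
    { sq := fun i h1 h2 => by
        simpa [sR, sq] using mk_eq_mk (RelR.order (d := d) (r := r) (n := n) i h1 (by omega))
      comm := fun i j h1 h2 h3 => by
        simpa [sR] using mk_eq_mk (RelR.comm (d := d) (r := r) (n := n) i j h1 h2 (by omega))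
      braid := fun i h1 h2 => by
        simpa [sR] using mk_eq_mk (RelR.braid (d := d) (r := r) (n := n) i h1 (by omega)) }
  sq_last := by
    simpa [sR, sq] using mk_eq_mk (RelR.order (d := d) (r := r) (n := n) n (by omega) le_rfl)
  order_extra := by simpa [sExtra] using mk_eq_mk (RelR.order_extra (d := d) (r := r) (n := n))
  comm_extra j h1 h2 := by
    simpa [sR, sExtra] using
      (mk_eq_mk (RelR.comm_extra (d := d) (r := r) (n := n) j h1 h2)).symm
  comm_last j h1 h2 := by
    simpa [sR] using (mk_eq_mk (RelR.comm_last (d := d) (r := r) (n := n) j h1 h2)).symm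
  extra_comm := by
    simpa [sR, sExtra, mul_assoc] using mk_eq_mk (RelR.extra_comm (d := d) (r := r) (n := n) hn)
  braid_last h := by
    simpa [sR] using mk_eq_mk (RelR.braid_last (d := d) (r := r) (n := n) h)
  square h := by
    simpa [sR] using mk_eq_mk (RelR.square (d := d) (r := r) (n := n) h)
  extra_long := by
    simpa [sR, sExtra] using mk_eq_mk (RelR.extra_long (d := d) (r := r) (n := n) hn)

/-- Setting s̃ = 1 lets the results on `SatR` apply to this presentation as well. The long relation
becomes s̃_n (s̃_{n-1} s̃_n)^{d-1} = s̃_{n-1}, equivalent to (s̃_n s̃_{n-1})^d = 1. -/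
theorem satR_sD (hd : 1 ≤ d) (hn : 2 ≤ n) : SatR d d n (sD d n) 1 where
  typeA :=
    { sq := fun i h1 h2 => by
        simpa [sD, sq] using mk_eq_mk (RelD.order (d := d) (n := n) i h1 (by omega))
      comm := fun i j h1 h2 h3 => by
        simpa [sD] using mk_eq_mk (RelD.comm (d := d) (n := n) i j h1 h2 (by omega))
      braid := fun i h1 h2 => by
        simpa [sD] using mk_eq_mk (RelD.braid (d := d) (n := n) i h1 (by omega)) }
  sq_last := by
    simpa [sD, sq] using mk_eq_mk (RelD.order (d := d) (n := n) n (by omega) le_rfl)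
  order_extra := one_pow _
  comm_extra j h1 h2 := by simp
  comm_last j h1 h2 := by
    simpa [sD] using (mk_eq_mk (RelD.comm_last (d := d) (n := n) j h1 h2)).symm
  extra_comm := by simp
  braid_last h := by
    simpa [sD] using mk_eq_mk (RelD.braid_last (d := d) (n := n) h)
  square h := by
    simpa [sD] using mk_eq_mk (RelD.square (d := d) (n := n) h)
  extra_long := by
    have h1 : (sD d n n * sD d n (n - 1)) ^ d = 1 := by
      simpa [sD] using mk_eq_mk (RelD.order_prod (d := d) (n := n) hn)
    have h2 : sD d n (n - 1) * sD d n (n - 1) = 1 := by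
      simpa [sD, sq] using mk_eq_mk (RelD.order (d := d) (n := n) (n - 1) (by omega) (by omega))
    obtain ⟨k, rfl⟩ := Nat.exists_eq_add_of_le' hd
    refine mul_right_cancel (b := sD (k + 1) n (n - 1)) ?_
    rw [Nat.add_sub_cancel, one_mul, mul_one, h2, ← h1, mul_assoc, mul_pow_mul, pow_succ']
    simp only [mul_assoc]

theorem closure_sR :
    Subgroup.closure (insert (sExtra d r n) (sR d r n '' Set.Icc 1 n)) = ⊤ := by
  rw [eq_top_iff, ← PresentedGroup.closure_range_of, Subgroup.closure_le]
  rintro _ ⟨⟨i, hi⟩ | _, rfl⟩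
  · refine Subgroup.subset_closure (Or.inr ⟨i, hi, ?_⟩)
    simp [sR, y, hi, PresentedGroup.of]
  · exact Subgroup.subset_closure (Or.inl rfl)

theorem closure_sD :
    Subgroup.closure (insert (1 : GD d n) (sD d n '' Set.Icc 1 n)) = ⊤ := by
  rw [eq_top_iff, ← PresentedGroup.closure_range_of, Subgroup.closure_le]
  rintro _ ⟨⟨i, hi⟩, rfl⟩
  refine Subgroup.subset_closure (Or.inr ⟨i, hi, ?_⟩)
  simp [sD, x, hi, PresentedGroup.of]

end Presentations

end CRG

theorem lemma2p7 (d n : ℕ) (hd : 1 ≤ d) (hn : 2 ≤ n) :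
    -- every element of `G(d,1,n)` has exactly one canonical word
    (∀ g : CRG.GOne d n, ∃! c : CRG.CanonicalWord d n, c.toGroup = g) ∧
    -- the homomorphism `τ : G(d,r,n) → G(d,1,n)`
    (∀ r : ℕ, r ∣ d →
      ∃ τ : CRG.GR d r n →* CRG.GOne d n,
        τ (CRG.sExtra d r n) = CRG.s d n n ^ r ∧
        τ (CRG.sR d r n n) = CRG.s d n n ^ (d - 1) * CRG.s d n (n - 1) * CRG.s d n n ∧
        (∀ i : ℕ, 1 ≤ i → i ≤ n - 1 → τ (CRG.sR d r n i) = CRG.s d n i) ∧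
        Function.Injective τ ∧
        Set.range τ =
          {g | ∃ c : CRG.CanonicalWord d n, c.toGroup = g ∧ c ∈ CRG.canonicalWords d r n}) ∧
    -- the case `r = d`, for the presentation of `G(d,d,n)` without the generator `s̃`
    (∃ ι : CRG.GD d n →* CRG.GOne d n,
      ι (CRG.sD d n n) = CRG.s d n n ^ (d - 1) * CRG.s d n (n - 1) * CRG.s d n n ∧
      (∀ i : ℕ, 1 ≤ i → i ≤ n - 1 → ι (CRG.sD d n i) = CRG.s d n i) ∧
      Function.Injective ι ∧
      Set.range ι =
        {g | ∃ c : CRG.CanonicalWord d n, c.toGroup = g ∧ c ∈ CRG.canonicalWords d d n}) := by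
  have hlast : CRG.image d n n = CRG.s d n n ^ (d - 1) * CRG.s d n (n - 1) * CRG.s d n n :=
    if_pos rfl
  refine ⟨fun g => ?_, fun r hr => ?_, ?_⟩
  · obtain ⟨c, rfl⟩ := CRG.CanonicalWord.toGroup_surjective hd hn g
    exact ⟨c, rfl, fun c' h => CRG.CanonicalWord.toGroup_injective hd hn h⟩
  · obtain ⟨τ, hz, hf⟩ := (CRG.satR_image hd hn hr).exists_hom
    exact ⟨τ, hz, (hf n (by omega) le_rfl).trans hlast,
      fun i h1 h2 => (hf i h1 (by omega)).trans (CRG.image_of_lt (by omega)),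
      (CRG.satR_sR hn).injective_of_image hd hn hr CRG.closure_sR hz hf,
      CRG.SatR.range_of_image hd hn hr CRG.closure_sR hz hf⟩
  · obtain ⟨ι, hf⟩ := (CRG.satR_image hd hn dvd_rfl).exists_hom_GD hd dvd_rfl
    -- The role of s̃ is played by 1, whose required image s_n^d is indeed 1.
    have hz : ι 1 = CRG.s d n n ^ d := by rw [map_one, (CRG.satOne_s hn).order]
    exact ⟨ι, (hf n (by omega) le_rfl).trans hlast,
      fun i h1 h2 => (hf i h1 (by omega)).trans (CRG.image_of_lt (by omega)),
      (CRG.satR_sD hd hn).injective_of_image hd hn dvd_rfl CRG.closure_sD hz hf,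
      CRG.SatR.range_of_image hd hn dvd_rfl CRG.closure_sD hz hf⟩
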